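/- **Setting.** Let $K$ be the number of drafters and $N_{max}\ge 1$ the draft length. A target language model $p(\cdot\mid c)$ and drafters $q_1(\cdot\mid c),\dots,q_K(\cdot\mid c)$ are next-token distributions on a finite vocabulary, for every context $c$. From a given prompt the target model generates $x^t\sim p(\cdot\mid \text{prompt},x^{1:t-1})$, $t\ge1$, and the target length is the random time $B=\min\{t\ge 1: x^t=\mathrm{EOS}\}$, assumed to be almost surely finite with $\mathbb E[B]<\infty$. For $s=0,1,2,\dots$ let $\alpha_{i,s}=1-d_{TV}(p(\cdot\mid c_{i,s}),q_i(\cdot\mid c_{i,s}))$ be the acceptance rate of the $s$-th token drafted by drafter $i$, where $c_{i,s}$ is the (random) context at which it is drafted; given the rates, the token passes verification with probability $\alpha_{i,s}$, independently of everything else. The $n$-th round ($n=0,1,\dots$) played with drafter $i$ uses the block of rates $\alpha_{i,nN_{max}+j}$, $0\le j<N_{max}$: the number $N_{acc}$ of accepted tokens is the length of the initial run of accepted tokens in the block, the round generates $N_{acc}+1$ tokens, and its block divergence (BD) reward is $\frac1{N_{max}}\sum_{j<N_{max}}\alpha_{i,nN_{max}+j}$. A bandit policy $\pi$ chooses the drafter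 of each round from its own internal randomness (a uniform seed independent of everything else) and the drafters, numbers of accepted tokens and BD rewards of the previous rounds; $\tau(\pi,B)$ is the first number of rounds after which at least $B$ tokens have been generated, and the expected stopping time regret is $$\mathrm{Reg}(\pi,B)=\mathbb E[\tau(\pi,B)]-\min_{\pi'}\mathbb E[\tau(\pi',B)],$$ where the expectation is over the target model's generation (hence over $B$), the acceptance rates, the verification and the policy, and the minimum (infimum) is over all bandit policies. MetaSD-UCB with the BD reward plays each drafter once, in order, and afterwards, when $t$ rounds are completed, a drafter maximizing $\hat\mu_i+\frac{1}{\sqrt{N_{max}}}\sqrt{\frac{2\ln t}{n_i}}$ (ties broken arbitrarily), where $\hat\mu_i$ is the mean of the observed rewards of drafter $i$ and $n_i$ is the number of rounds in which it was played. **Assumption.** For each $i$ the rates $(\alpha_{i,s})_{s}$ are i.i.d. from a distribution $\nu_i$ with mean $\alpha_i$, the rates of different drafters are independent, and the rates are independent of $B$. **Theorem.** Suppose that there is a unique best drafter $i^\star$, that is, $\Delta(\alpha_i)=\alpha_{i^\star}-\alpha_i>0$ for all $i\ne i^\star$. For all $K$, $N_{max}$ and $s_0>1$ there are constants $C,C'>0$,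 depending only on $K,N_{max},s_0$ (in particular not on $B$ and the $\Delta(\alpha_i)$), such that, whenever $\sum_{i\ne i^\star}\frac1{\Delta(\alpha_i)^2}\ge s_0$, MetaSD-UCB $\pi$ satisfies $$\mathrm{Reg}(\pi,B)<\sum_{i\neq i^\star}\frac{8}{N_{max}\,\Delta(\alpha_i)^2}\Big(\ln \mathbb E[B]+\ln\ln\Big(\sum_{j\ne i^\star}\frac1{\Delta(\alpha_j)^2}\Big)+C'\Big)+C .$$ -/

import Mathlib

open MeasureTheory ProbabilityTheory

namespace MetaSD

noncomputable section

/-- The language models: next-token distributions of the target model and of the `K` drafters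
given a context, the prompt that is completed, and the end-of-sentence token. -/
structure Models (V : Type*) (K : ℕ) where
  target : List V → PMF V
  drafter : Fin K → List V → PMF V
  prompt : List V
  eos : V

/-- Total variation distance of two distributions on a finite vocabulary. -/
def tvDist {V : Type*} [Fintype V] (p q : PMF V) : ℝ :=
  (1 / 2) * ∑ v, |(p v).toReal - (q v).toReal|

/-- The random variables of a generation.
* `token t` (for `t ≥ 1`) is the `t`-th token `x^t` generated by the target model.
* `ctx i s` is the context at which drafter `i` drafts its `s`-th token (`s = 0, 1, 2, …` counts
  all tokens drafted by drafter `i`, whether accepted or not), and `coin i s` is the uniform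
  variable used in the verification of that token.
* `seed` is the internal randomness of the bandit policy. -/
structure Generation (Ω V : Type*) (K : ℕ) where
  token : ℕ → Ω → V
  ctx : Fin K → ℕ → Ω → List V
  coin : Fin K → ℕ → Ω → ℝ
  seed : Ω → ℝ

section Rounds

variable {Ω V : Type*} [Fintype V] {K : ℕ} (M : Models V K) (G : Generation Ω V K)

/-- The random target length `B = min {t ≥ 1 : x^t = EOS}`. -/
def targetLength (ω : Ω) : ℕ := sInf {t : ℕ | 1 ≤ t ∧ G.token t ω = M.eos}

/-- The acceptance rate of the `s`-th token drafted by drafter `i`: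
`α_{i,s} = 1 - d_TV(p(· | c), q_i(· | c))`, where `c` is the context of that token. -/
def rate (i : Fin K) (s : ℕ) (ω : Ω) : ℝ :=
  1 - tvDist (M.target (G.ctx i s ω)) (M.drafter i (G.ctx i s ω))

/-- The `s`-th token drafted by drafter `i` passes the verification
(this has probability `α_{i,s}` given `α_{i,s}`). -/
def Accepted (i : Fin K) (s : ℕ) (ω : Ω) : Prop := G.coin i s ω < rate M G i s ω

open Classical in
/-- The number of accepted tokens in the round number `n` (`n = 0, 1, 2, …`) played with
drafter `i` with draft length `N`: the length of the initial run of accepted tokens in the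
block `n * N, …, n * N + N - 1`. -/
def numAccepted (N : ℕ) (i : Fin K) (n : ℕ) (ω : Ω) : ℕ :=
  ((Finset.range N).filter fun j => ∀ j' ≤ j, Accepted M G i (n * N + j') ω).card

/-- The block divergence reward of the round number `n` played with drafter `i`. -/
def bdReward (N : ℕ) (i : Fin K) (n : ℕ) (ω : Ω) : ℝ :=
  (1 / (N : ℝ)) * ∑ j ∈ Finset.range N, rate M G i (n * N + j) ω

end Rounds

/-- What the bandit observes in one round: the drafter played, the number of accepted tokens and
the block divergence reward. -/
abbrev Obs (K : ℕ) : Type := Fin K × ℕ × ℝ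

/-- Number of rounds in which drafter `i` was played. -/
def pulls {K t : ℕ} (h : Fin t → Obs K) (i : Fin K) : ℕ :=
  (Finset.univ.filter fun k => (h k).1 = i).card

/-- Empirical mean of the rewards of drafter `i`. -/
def empMean {K t : ℕ} (h : Fin t → Obs K) (i : Fin K) : ℝ :=
  (∑ k ∈ Finset.univ.filter (fun k => (h k).1 = i), (h k).2.2) / (pulls h i : ℝ)

/-- A (possibly randomized) bandit policy: the drafter to play after `t` completed rounds is a
measurable function of the internal random seed and of the observations so far. -/
structure Policy (K : ℕ) where
  act : (t : ℕ) → ℝ → (Fin t → Obs K) → Fin K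
  measurable_act : ∀ t, Measurable fun z : ℝ × (Fin t → Obs K) => act t z.1 z.2

/-- The upper confidence index of drafter `i` after `t` rounds, with exploration parameter `β`. -/
def ucbIndex {K t : ℕ} (β : ℝ) (h : Fin t → Obs K) (i : Fin K) : ℝ :=
  empMean h i + β * Real.sqrt (2 * Real.log (t : ℝ) / (pulls h i : ℝ))

/-- `π` is MetaSD-UCB with exploration parameter `β` (and some way of breaking ties): each drafter
is played once, in order, and from then on a drafter of maximal upper confidence index. -/
def IsMetaSDUCB {K : ℕ} (β : ℝ) (π : Policy K) : Prop :=
  ∀ (t : ℕ) (u : ℝ) (h : Fin t → Obs K),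
    (t < K → (π.act t u h : ℕ) = t) ∧
    (K ≤ t → ∀ i, ucbIndex β h i ≤ ucbIndex β h (π.act t u h))

section Run

variable {Ω V : Type*} [Fintype V] {K : ℕ} (M : Models V K) (G : Generation Ω V K)

/-- The observations of the first `t` rounds when the drafters are chosen by `π`. -/
def history (N : ℕ) (π : Policy K) (ω : Ω) : (t : ℕ) → Fin t → Obs K
  | 0 => Fin.elim0
  | t + 1 =>
    let h := history N π ω t
    let i := π.act t (G.seed ω) h
    Fin.snoc (α := fun _ => Obs K) h
      (i, numAccepted M G N i (pulls h i) ω, bdReward M G N i (pulls h i) ω)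

/-- The number of tokens generated in the first `t` rounds: each round yields the accepted tokens
and one further token. -/
def tokensGenerated (N : ℕ) (π : Policy K) (t : ℕ) (ω : Ω) : ℕ :=
  ∑ k : Fin t, ((history M G N π ω t k).2.1 + 1)

/-- The stopping time `τ(π, B)`: the number of rounds until `B` tokens are generated. -/
def stoppingTime (N : ℕ) (π : Policy K) (ω : Ω) : ℕ :=
  sInf {t : ℕ | targetLength M G ω ≤ tokensGenerated M G N π t ω}

variable [MeasurableSpace Ω] (P : Measure Ω)

/-- `E[B]`. -/
def expectedLength : ℝ := ∫ ω, (targetLength M G ω : ℝ) ∂P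

/-- `E[τ(π, B)]`, over the target generations, the verification and the policy. -/
def expectedStoppingTime (N : ℕ) (π : Policy K) : ℝ :=
  ∫ ω, (stoppingTime M G N π ω : ℝ) ∂P

/-- The expected stopping time regret `E[τ(π, B)] - E[τ(π⋆, B)]`, where `π⋆` minimizes the
expected stopping time over all policies. -/
def expectedRegret (N : ℕ) (π : Policy K) : ℝ :=
  expectedStoppingTime M G P N π - ⨅ π' : Policy K, expectedStoppingTime M G P N π'

/-- The tokens are generated by the target model, `x^t ∼ p(· | prompt, x^{1:t-1})`, the token
EOS appears almost surely, and `B` has finite expectation. -/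
structure IsTargetGeneration : Prop where
  measurable_token : ∀ t, Measurable[_, ⊤] (G.token t)
  law_token : ∀ (n : ℕ) (x : Fin n → V),
    P {ω | ∀ k : Fin n, G.token (k + 1) ω = x k} =
      ∏ k : Fin n, M.target (M.prompt ++ (List.ofFn x).take k) (x k)
  eos_appears : ∀ᵐ ω ∂P, ∃ t, 1 ≤ t ∧ G.token t ω = M.eos
  integrable_length : Integrable (fun ω => (targetLength M G ω : ℝ)) P

/-- The acceptance rates of drafter `i` are i.i.d. with law `ν i`, those of different drafters are
independent, and the acceptance rates are independent of `B`. -/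
structure StationaryRates (ν : Fin K → Measure ℝ) : Prop where
  measurable_ctx : ∀ i s, Measurable[_, ⊤] (G.ctx i s)
  law_rate : ∀ i s, P.map (rate M G i s) = ν i
  indep_rate : iIndepFun (fun k : Fin K × ℕ => rate M G k.1 k.2) P
  indep_length :
    IndepFun (fun ω (k : Fin K × ℕ) => rate M G k.1 k.2 ω) (targetLength M G) P

/-- The verification coins are i.i.d. uniform on `[0, 1]` and independent of the acceptance rates
and of `B`; the seed of the policy is uniform on `[0, 1]` and independent of all of these. -/
structure FreshRandomness : Prop where
  measurable_coin : ∀ i s, Measurable (G.coin i s)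
  law_coin : ∀ i s, P.map (G.coin i s) = volume.restrict (Set.Icc 0 1)
  indep_coin : iIndepFun (fun k : Fin K × ℕ => G.coin k.1 k.2) P
  indep_coin_rate :
    IndepFun (fun ω (k : Fin K × ℕ) => G.coin k.1 k.2 ω)
      (fun ω => ((fun k : Fin K × ℕ => rate M G k.1 k.2 ω), targetLength M G ω)) P
  measurable_seed : Measurable G.seed
  law_seed : P.map G.seed = volume.restrict (Set.Icc 0 1)
  indep_seed :
    IndepFun G.seed
      (fun ω => ((fun k : Fin K × ℕ => G.coin k.1 k.2 ω),
        (fun k : Fin K × ℕ => rate M G k.1 k.2 ω), targetLength M G ω)) P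

end Run

end

end MetaSD

/-! A round with drafter `i` yields on average `m i = 1 + ∑_{j<N} α_i^(j+1)` tokens, which increases
with `α_i`. Whether the run is still going after `k` rounds is decided by the seed, `B` and those
`k` rounds, and the token count of the next round is independent of all of these. Hence Wald's
identity (`integral_excess_stoppingTime`): up to the stopping time, tokens generated minus `∑ m i *
n_i` has mean zero, where `n_i` counts the plays of `i`.

Since at least `B` tokens are generated, every policy needs at least `E[B] / m istar` rounds on
average (`expectedLength_div_le`). Since the last round overshoots by at most `N`, any given policy
satisfies `m istar * E[τ] ≤ E[B] + N + ∑ (m istar - m i) * E[n_i]` (`mul_expectedStoppingTime_le`).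
As `m istar - m i ≤ m istar`, the regret is at most `N` plus the expected number of suboptimal
rounds.

These are counted by the usual UCB argument (`integral_pulls_le`). A block averages `N` rates, so
Hoeffding's inequality justifies confidence intervals narrower by `1/√N`. Drafter `i` is played
about `8 ln B / (N Δ²)` times, plus the number of times a confidence interval fails, which is
summable in expectation. The horizon is random, but `τ ≤ B`, the failure count is bounded uniformly
in time, and concavity of `ln` replaces `ln B` by `ln E[B]`.

The resulting bound has no iterated logarithm; `C'` only has to make `ln ln (∑ 1/Δ²) + C'`
nonnegative. -/

namespace MetaSD

/-! ### Independence of functions of disjoint parts of an independent family -/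

section Independence

variable {Ω : Type*}

/-- The σ-algebra generated by the members of a family with index in `S`. -/
abbrev sigmaOf {ι : Type*} (X : ι → Ω → ℝ) (S : Set ι) : MeasurableSpace Ω :=
  ⨆ i ∈ S, MeasurableSpace.comap (X i) inferInstance

lemma measurable_sigmaOf {ι : Type*} (X : ι → Ω → ℝ) {S : Set ι} {i : ι} (hi : i ∈ S) :
    Measurable[sigmaOf X S] (X i) := by
  rw [measurable_iff_comap_le]
  exact le_iSup₂ (f := fun i (_ : i ∈ S) => MeasurableSpace.comap (X i) inferInstance) i hi

variable [MeasurableSpace Ω] {P : Measure Ω}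

/-- Two mutually independent families that are independent of each other form together a mutually
independent family. -/
lemma iIndepFun_sumElim {ι κ : Type*} {f : ι → Ω → ℝ} {g : κ → Ω → ℝ}
    (hf : iIndepFun f P) (hg : iIndepFun g P)
    (hfg : IndepFun (fun ω i => f i ω) (fun ω j => g j ω) P) :
    iIndepFun (Sum.elim f g) P := by
  classical
  rw [iIndepFun_iff_measure_inter_preimage_eq_mul] at hf hg ⊢
  intro S sets hS
  -- A finite intersection splits into a left and a right cylinder event, each an event about one
  -- whole family, so `hfg` separates them and `hf`, `hg` factor each.
  have hA : MeasurableSet {x : ι → ℝ | ∀ i ∈ S.toLeft, x i ∈ sets (Sum.inl i)} := by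
    have : {x : ι → ℝ | ∀ i ∈ S.toLeft, x i ∈ sets (Sum.inl i)}
        = ⋂ i ∈ S.toLeft, (fun x : ι → ℝ => x i) ⁻¹' sets (Sum.inl i) := by
      ext; simp
    rw [this]
    exact Finset.measurableSet_biInter _ fun i hi =>
      measurable_pi_apply i (hS _ (Finset.mem_toLeft.1 hi))
  have hB : MeasurableSet {x : κ → ℝ | ∀ i ∈ S.toRight, x i ∈ sets (Sum.inr i)} := by
    have : {x : κ → ℝ | ∀ i ∈ S.toRight, x i ∈ sets (Sum.inr i)}
        = ⋂ i ∈ S.toRight, (fun x : κ → ℝ => x i) ⁻¹' sets (Sum.inr i) := by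
      ext; simp
    rw [this]
    exact Finset.measurableSet_biInter _ fun i hi =>
      measurable_pi_apply i (hS _ (Finset.mem_toRight.1 hi))
  have key := hfg.measure_inter_preimage_eq_mul _ _ hA hB
  have e1 : (fun ω i => f i ω) ⁻¹' {x : ι → ℝ | ∀ i ∈ S.toLeft, x i ∈ sets (Sum.inl i)}
      = ⋂ i ∈ S.toLeft, f i ⁻¹' sets (Sum.inl i) := by ext; simp
  have e2 : (fun ω i => g i ω) ⁻¹' {x : κ → ℝ | ∀ i ∈ S.toRight, x i ∈ sets (Sum.inr i)}
      = ⋂ i ∈ S.toRight, g i ⁻¹' sets (Sum.inr i) := by ext; simp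
  have e3 : ⋂ i ∈ S, Sum.elim f g i ⁻¹' sets i
      = (⋂ i ∈ S.toLeft, f i ⁻¹' sets (Sum.inl i)) ∩ ⋂ i ∈ S.toRight, g i ⁻¹' sets (Sum.inr i) := by
    ext ω
    simp only [Set.mem_iInter, Set.mem_inter_iff, Finset.mem_toLeft, Finset.mem_toRight,
      Sum.forall, Sum.elim_inl, Sum.elim_inr]
  rw [e1, e2, hf _ fun i hi => hS _ (Finset.mem_toLeft.1 hi),
    hg _ fun i hi => hS _ (Finset.mem_toRight.1 hi)] at key
  rw [e3, key]
  conv_rhs => rw [← Finset.toLeft_disjSum_toRight (u := S), Finset.prod_disjSum]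
  rfl

/-- Reduces an independence claim to checking which members of the family each side reads. -/
lemma indepFun_of_measurable_sigmaOf {ι β γ : Type*} [MeasurableSpace β] [MeasurableSpace γ]
    {X : ι → Ω → ℝ} (h : iIndepFun X P) (hX : ∀ i, Measurable (X i)) {S T : Set ι}
    (hST : Disjoint S T) {f : Ω → β} {g : Ω → γ}
    (hf : Measurable[sigmaOf X S] f) (hg : Measurable[sigmaOf X T] g) : IndepFun f g P := by
  rw [IndepFun_iff_Indep]
  have := indep_iSup_of_disjoint (fun i => (hX i).comap_le) h.iIndep hST
  exact indep_of_indep_of_le_left (indep_of_indep_of_le_right this hg.comap_le) hf.comap_le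

lemma iIndepFun_unit (f : Ω → ℝ) [IsProbabilityMeasure P] : iIndepFun (fun _ : Unit => f) P :=
  iIndepFun.of_subsingleton

end Independence

end MetaSD

namespace MetaSD

/-! ### Histories as deterministic functions of the seed and a table of rounds -/

section Histories

variable {K : ℕ}

/-- The observations of the first `t` rounds played by `π` with seed `u`, when the `n`-th round
played with drafter `i` is observed as `Y i n`. -/
def historyOf (π : Policy K) (u : ℝ) (Y : Fin K → ℕ → ℕ × ℝ) : (t : ℕ) → Fin t → Obs K
  | 0 => Fin.elim0
  | t + 1 =>
    let h := historyOf π u Y t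
    Fin.snoc (α := fun _ => Obs K) h (π.act t u h, Y (π.act t u h) (pulls h (π.act t u h)))

lemma pulls_snoc {t : ℕ} (h : Fin t → Obs K) (o : Obs K) (i : Fin K) :
    pulls (Fin.snoc (α := fun _ => Obs K) h o) i = pulls h i + if o.1 = i then 1 else 0 := by
  unfold pulls
  simp only [Finset.card_filter]
  rw [Fin.sum_univ_castSucc]
  simp only [Fin.snoc_castSucc, Fin.snoc_last]

lemma pulls_historyOf_succ (π : Policy K) (u : ℝ) (Y : Fin K → ℕ → ℕ × ℝ) (t : ℕ) (i : Fin K) :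
    pulls (historyOf π u Y (t + 1)) i = pulls (historyOf π u Y t) i +
      if π.act t u (historyOf π u Y t) = i then 1 else 0 :=
  pulls_snoc _ _ _

lemma pulls_historyOf_mono (π : Policy K) (u : ℝ) (Y : Fin K → ℕ → ℕ × ℝ) (i : Fin K) :
    Monotone fun t => pulls (historyOf π u Y t) i :=
  monotone_nat_of_le_succ fun t => by rw [pulls_historyOf_succ]; omega

lemma pulls_le {t : ℕ} (h : Fin t → Obs K) (i : Fin K) : pulls h i ≤ t := by
  unfold pulls
  exact (Finset.card_filter_le _ _).trans (by simp)

lemma sum_pulls {t : ℕ} (h : Fin t → Obs K) : ∑ i, pulls h i = t := by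
  unfold pulls
  rw [← Finset.card_eq_sum_card_fiberwise (fun _ _ => Finset.mem_coe.2 (Finset.mem_univ _))]
  simp

/-- A history in which drafter `i` was played at most `n` times does not depend on what the round
number `n` of that drafter would bring. -/
lemma historyOf_update (π : Policy K) (u : ℝ) (Y : Fin K → ℕ → ℕ × ℝ) (i : Fin K) (n : ℕ)
    (y : ℕ × ℝ) (t : ℕ) (h : pulls (historyOf π u Y t) i ≤ n) :
    historyOf π u (Function.update Y i (Function.update (Y i) n y)) t = historyOf π u Y t := by
  induction t with
  | zero => rfl
  | succ t ih =>
    have h1 := pulls_historyOf_succ π u Y t i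
    have ih := ih (by omega)
    simp only [historyOf, ih]
    congr 2
    -- If `i` is played now, its count rises to at most `n`, so it was below `n` and the altered
    -- entry is not the one read.
    by_cases hi : π.act t u (historyOf π u Y t) = i
    · rw [if_pos hi] at h1
      rw [hi, Function.update_self, Function.update_of_ne (by omega)]
    · rw [Function.update_of_ne hi]

/-- Whether drafter `i` is played for the `n`-th time after a history does not depend on what
that round brings. -/
lemma historyOf_update_and_iff (π : Policy K) (u : ℝ) (Y : Fin K → ℕ → ℕ × ℝ) (i : Fin K) (n : ℕ)
    (y : ℕ × ℝ) (t : ℕ) (Q : (Fin t → Obs K) → Prop) :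
    (pulls (historyOf π u (Function.update Y i (Function.update (Y i) n y)) t) i = n ∧
      Q (historyOf π u (Function.update Y i (Function.update (Y i) n y)) t)) ↔
    (pulls (historyOf π u Y t) i = n ∧ Q (historyOf π u Y t)) := by
  constructor
  · intro h
    -- Applied to the altered table, writing the original entry back.
    have := historyOf_update π u (Function.update Y i (Function.update (Y i) n y)) i n (Y i n) t
      h.1.le
    simp only [Function.update_self, Function.update_idem, Function.update_eq_self] at this
    rwa [← this] at h
  · intro h
    rwa [historyOf_update _ _ _ _ _ _ _ h.1.le]

/-- The number of tokens generated in the rounds of a history. -/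
def tokensOf {t : ℕ} (h : Fin t → Obs K) : ℕ := ∑ k, ((h k).2.1 + 1)

lemma tokensOf_historyOf_succ (π : Policy K) (u : ℝ) (Y : Fin K → ℕ → ℕ × ℝ) (t : ℕ) :
    tokensOf (historyOf π u Y (t + 1)) = tokensOf (historyOf π u Y t) +
      ((Y (π.act t u (historyOf π u Y t))
        (pulls (historyOf π u Y t) (π.act t u (historyOf π u Y t)))).1 + 1) := by
  unfold tokensOf
  rw [Fin.sum_univ_castSucc]
  simp only [historyOf, Fin.snoc_castSucc, Fin.snoc_last]

lemma le_tokensOf {t : ℕ} (h : Fin t → Obs K) : t ≤ tokensOf h := by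
  unfold tokensOf
  calc t = ∑ _k : Fin t, 1 := by simp
    _ ≤ _ := Finset.sum_le_sum fun k _ => by omega

lemma tokensOf_historyOf_mono (π : Policy K) (u : ℝ) (Y : Fin K → ℕ → ℕ × ℝ) :
    Monotone fun t => tokensOf (historyOf π u Y t) :=
  monotone_nat_of_le_succ fun t => by rw [tokensOf_historyOf_succ]; omega

lemma measurable_pulls {t : ℕ} (i : Fin K) : Measurable fun h : Fin t → Obs K => pulls h i := by
  unfold pulls
  simp only [Finset.card_filter]
  refine Finset.measurable_sum _ fun k _ => ?_
  refine Measurable.ite ?_ measurable_const measurable_const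
  exact (measurable_fst.comp (measurable_pi_apply k)) (measurableSet_singleton i)

lemma measurable_tokensOf {t : ℕ} : Measurable fun h : Fin t → Obs K => tokensOf h := by
  unfold tokensOf
  refine Finset.measurable_sum _ fun k _ => ?_
  exact (measurable_fst.comp (measurable_snd.comp (measurable_pi_apply k))).add_const 1

lemma measurable_historyOf (π : Policy K) (t : ℕ) :
    Measurable fun z : ℝ × (Fin K → ℕ → ℕ × ℝ) => historyOf π z.1 z.2 t := by
  induction t with
  | zero => exact measurable_pi_iff.2 fun k => k.elim0
  | succ t ih =>
    have hact : Measurable fun z : ℝ × (Fin K → ℕ → ℕ × ℝ) =>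
        π.act t z.1 (historyOf π z.1 z.2 t) :=
      (π.measurable_act t).comp (measurable_fst.prodMk ih)
    have hpulls : Measurable fun z : ℝ × (Fin K → ℕ → ℕ × ℝ) =>
        pulls (historyOf π z.1 z.2 t) (π.act t z.1 (historyOf π z.1 z.2 t)) := by
      have : Measurable fun p : (Fin t → Obs K) × Fin K => pulls p.1 p.2 :=
        measurable_from_prod_countable_left fun i => measurable_pulls i
      exact this.comp (ih.prodMk hact)
    -- The entry read has a random index, but there are only countably many indices, so fixed ones
    -- suffice.
    have heval : Measurable fun p : (Fin K → ℕ → ℕ × ℝ) × (Fin K × ℕ) => p.1 p.2.1 p.2.2 :=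
      measurable_from_prod_countable_left fun q =>
        (measurable_pi_apply q.2).comp (measurable_pi_apply q.1)
    refine measurable_pi_iff.2 fun k => ?_
    induction k using Fin.lastCases with
    | last =>
      simp only [historyOf, Fin.snoc_last]
      exact hact.prodMk (heval.comp (measurable_snd.prodMk (hact.prodMk hpulls)))
    | cast k =>
      simp only [historyOf, Fin.snoc_castSucc]
      exact (measurable_pi_apply k).comp ih

end Histories

end MetaSD

namespace MetaSD

/-! ### Pathwise facts about rates, token counts and the stopping time -/

section Deterministic

variable {Ω V : Type*} [Fintype V] {K : ℕ} (M : Models V K) (G : Generation Ω V K)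

lemma sum_toReal_eq_one (p : PMF V) : ∑ v, (p v).toReal = 1 := by
  rw [← ENNReal.toReal_sum fun v _ => p.apply_ne_top v, ← tsum_fintype (L := .unconditional V), p.tsum_coe]
  rfl

lemma tvDist_nonneg (p q : PMF V) : 0 ≤ tvDist p q := by
  unfold tvDist
  positivity

lemma tvDist_le_one (p q : PMF V) : tvDist p q ≤ 1 := by
  have h : ∑ v, |(p v).toReal - (q v).toReal| ≤ ∑ v, ((p v).toReal + (q v).toReal) := by
    refine Finset.sum_le_sum fun v _ => ?_
    rw [abs_le]
    constructor <;> linarith [ENNReal.toReal_nonneg (a := p v), ENNReal.toReal_nonneg (a := q v)]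
  rw [Finset.sum_add_distrib, sum_toReal_eq_one, sum_toReal_eq_one] at h
  unfold tvDist
  linarith

lemma rate_mem_Icc (i : Fin K) (s : ℕ) (ω : Ω) : rate M G i s ω ∈ Set.Icc (0 : ℝ) 1 := by
  have h0 := tvDist_nonneg (M.target (G.ctx i s ω)) (M.drafter i (G.ctx i s ω))
  have h1 := tvDist_le_one (M.target (G.ctx i s ω)) (M.drafter i (G.ctx i s ω))
  unfold rate
  constructor <;> linarith

/-- What is observed in the round number `n` played with drafter `i`. -/
noncomputable def roundOf (N : ℕ) (ω : Ω) (i : Fin K) (n : ℕ) : ℕ × ℝ :=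
  (numAccepted M G N i n ω, bdReward M G N i n ω)

lemma numAccepted_le (N : ℕ) (i : Fin K) (n : ℕ) (ω : Ω) : numAccepted M G N i n ω ≤ N := by
  classical
  unfold numAccepted
  exact (Finset.card_filter_le _ _).trans (by simp)

lemma history_eq_historyOf (N : ℕ) (π : Policy K) (ω : Ω) (t : ℕ) :
    history M G N π ω t = historyOf π (G.seed ω) (roundOf M G N ω) t := by
  induction t with
  | zero => rfl
  | succ t ih => simp only [history, historyOf, ih, roundOf]

lemma tokensGenerated_eq (N : ℕ) (π : Policy K) (t : ℕ) (ω : Ω) :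
    tokensGenerated M G N π t ω =
      tokensOf (historyOf π (G.seed ω) (roundOf M G N ω) t) := by
  unfold tokensGenerated tokensOf
  rw [history_eq_historyOf]

/-- The stopping property: continuing past round `k` depends only on `B` and the first `k` rounds.
It uses that token counts increase, and that they reach `B`, so the infimum is over a nonempty set.
-/
lemma lt_stoppingTime_iff (N : ℕ) (π : Policy K) (ω : Ω) (k : ℕ) :
    k < stoppingTime M G N π ω ↔
      tokensOf (historyOf π (G.seed ω) (roundOf M G N ω) k) < targetLength M G ω := by
  have hne : {t : ℕ | targetLength M G ω ≤ tokensGenerated M G N π t ω}.Nonempty :=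
    ⟨targetLength M G ω, by
      rw [Set.mem_ofPred_eq, tokensGenerated_eq]
      exact le_tokensOf _⟩
  constructor
  · intro h
    have := Nat.notMem_of_lt_sInf h
    rwa [Set.mem_ofPred_eq, tokensGenerated_eq, not_le] at this
  · intro h
    by_contra hk
    have h1 := Nat.sInf_mem hne
    rw [Set.mem_ofPred_eq, tokensGenerated_eq] at h1
    have := tokensOf_historyOf_mono π (G.seed ω) (roundOf M G N ω) (not_lt.1 hk)
    unfold stoppingTime at this
    simp only at this
    omega

/-- Even a round that rejects every draft yields one token. This makes the integrable `B` dominate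
all stopped counts. -/
lemma stoppingTime_le (N : ℕ) (π : Policy K) (ω : Ω) :
    stoppingTime M G N π ω ≤ targetLength M G ω := by
  by_contra h
  have := (lt_stoppingTime_iff M G N π ω _).1 (not_le.1 h)
  have := le_tokensOf (historyOf π (G.seed ω) (roundOf M G N ω) (targetLength M G ω))
  omega

lemma targetLength_le_tokensOf (N : ℕ) (π : Policy K) (ω : Ω) :
    targetLength M G ω ≤
      tokensOf (historyOf π (G.seed ω) (roundOf M G N ω) (stoppingTime M G N π ω)) :=
  not_lt.1 fun h => lt_irrefl _ ((lt_stoppingTime_iff M G N π ω _).2 h)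

/-- Before the last round there are fewer than `B` tokens, and that round adds at most `N + 1`. -/
lemma tokensOf_le (N : ℕ) (π : Policy K) (ω : Ω) :
    tokensOf (historyOf π (G.seed ω) (roundOf M G N ω) (stoppingTime M G N π ω)) ≤
      targetLength M G ω + N := by
  rcases h : stoppingTime M G N π ω with _ | k
  · simp [tokensOf]
  · have := (lt_stoppingTime_iff M G N π ω k).1 (by omega)
    rw [tokensOf_historyOf_succ]
    have h2 := numAccepted_le M G N
      (π.act k (G.seed ω) (historyOf π (G.seed ω) (roundOf M G N ω) k))
      (pulls (historyOf π (G.seed ω) (roundOf M G N ω) k)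
        (π.act k (G.seed ω) (historyOf π (G.seed ω) (roundOf M G N ω) k))) ω
    simp only [roundOf] at *
    omega

end Deterministic

/-! ### Measurability, also with respect to sub-σ-algebras -/

section Measurability

/-- The σ-algebra is a free argument, and only the variables of this block are required to be
measurable, so that the lemma also applies to the σ-algebra generated by a subfamily of the sources.
-/
lemma measurable_numAccepted {Ω V : Type*} {m : MeasurableSpace Ω} [Fintype V] {K : ℕ}
    (M : Models V K) (G : Generation Ω V K) (N : ℕ) (i : Fin K) (n : ℕ)
    (hc : ∀ j < N, Measurable (G.coin i (n * N + j)))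
    (hr : ∀ j < N, Measurable (rate M G i (n * N + j))) :
    Measurable (numAccepted M G N i n) := by
  classical
  have : numAccepted M G N i n = fun ω => ∑ j ∈ Finset.range N,
      if ∀ j' ≤ j, Accepted M G i (n * N + j') ω then 1 else 0 := by
    funext ω
    unfold numAccepted
    rw [Finset.card_filter]
  rw [this]
  refine Finset.measurable_sum _ fun j hj => ?_
  refine Measurable.ite ?_ measurable_const measurable_const
  have e : {ω | ∀ j' ≤ j, Accepted M G i (n * N + j') ω}
      = ⋂ j' ∈ Finset.range (j + 1), {ω | Accepted M G i (n * N + j') ω} := by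
    ext ω; simp
  rw [e]
  refine Finset.measurableSet_biInter _ fun j' hj' => ?_
  rw [Finset.mem_range] at hj hj'
  exact measurableSet_lt (hc _ (by omega)) (hr _ (by omega))

lemma measurable_bdReward {Ω V : Type*} {m : MeasurableSpace Ω} [Fintype V] {K : ℕ}
    (M : Models V K) (G : Generation Ω V K) (N : ℕ) (i : Fin K) (n : ℕ)
    (hr : ∀ j < N, Measurable (rate M G i (n * N + j))) :
    Measurable (bdReward M G N i n) := by
  unfold bdReward
  exact (Finset.measurable_sum _ fun j hj => hr j (Finset.mem_range.1 hj)).const_mul _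

lemma measurable_roundOf_apply {Ω V : Type*} {m : MeasurableSpace Ω} [Fintype V] {K : ℕ}
    (M : Models V K) (G : Generation Ω V K) (N : ℕ) (i : Fin K) (n : ℕ)
    (hc : ∀ j < N, Measurable (G.coin i (n * N + j)))
    (hr : ∀ j < N, Measurable (rate M G i (n * N + j))) :
    Measurable fun ω => roundOf M G N ω i n :=
  (measurable_numAccepted M G N i n hc hr).prodMk (measurable_bdReward M G N i n hr)

/-- Round `(i, n)` is overwritten by a constant, so nothing is asked of it: the masked data are
measurable without the sources of that round. -/
lemma measurable_masked {Ω : Type*} {m : MeasurableSpace Ω} {K : ℕ} {u B : Ω → ℝ}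
    {Y : Ω → Fin K → ℕ → ℕ × ℝ} (i : Fin K) (n : ℕ) (hu : Measurable u) (hB : Measurable B)
    (hY : ∀ i' n', ¬ (i' = i ∧ n' = n) → Measurable fun ω => Y ω i' n') :
    Measurable fun ω => ((u ω, Function.update (Y ω) i (Function.update (Y ω i) n (0, 0))), B ω) := by
  refine (hu.prodMk (measurable_pi_iff.2 fun i' => measurable_pi_iff.2 fun n' => ?_)).prodMk hB
  by_cases hi : i' = i
  · subst hi
    simp only [Function.update_self]
    by_cases hn : n' = n
    · subst hn
      simp only [Function.update_self]
      exact measurable_const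
    · simp only [Function.update_of_ne hn]
      exact hY _ _ fun h => hn h.2
  · simp only [Function.update_of_ne hi]
    exact hY _ _ fun h => hi h.1

lemma measurableSet_accepted {Ω V : Type*} {m : MeasurableSpace Ω} [Fintype V] {K : ℕ}
    (M : Models V K) (G : Generation Ω V K) (i : Fin K) (s : ℕ)
    (hc : Measurable (G.coin i s)) (hr : Measurable (rate M G i s)) :
    MeasurableSet {ω | Accepted M G i s ω} :=
  measurableSet_lt hc hr

lemma measurableSet_forall_lt_accepted {Ω V : Type*} {m : MeasurableSpace Ω} [Fintype V] {K : ℕ}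
    (M : Models V K) (G : Generation Ω V K) (i : Fin K) (s k : ℕ)
    (hc : ∀ j < k, Measurable (G.coin i (s + j)))
    (hr : ∀ j < k, Measurable (rate M G i (s + j))) :
    MeasurableSet {ω | ∀ j < k, Accepted M G i (s + j) ω} := by
  have : {ω | ∀ j < k, Accepted M G i (s + j) ω} =
      ⋂ j ∈ Finset.range k, {ω | Accepted M G i (s + j) ω} := by
    ext ω; simp
  rw [this]
  refine Finset.measurableSet_biInter _ fun j hj => ?_
  rw [Finset.mem_range] at hj
  exact measurableSet_accepted M G i _ (hc j hj) (hr j hj)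

lemma measurable_rate {Ω V : Type*} [MeasurableSpace Ω] [Fintype V] {K : ℕ}
    (M : Models V K) (G : Generation Ω V K) (i : Fin K) (s : ℕ)
    (h : Measurable[_, ⊤] (G.ctx i s)) : Measurable (rate M G i s) :=
  (@measurable_from_top _ _ _
    fun c => 1 - tvDist (M.target c) (M.drafter i c)).comp h

lemma measurable_targetLength {Ω V : Type*} [MeasurableSpace Ω] [Fintype V] {K : ℕ}
    (M : Models V K) (G : Generation Ω V K) (h : ∀ t, Measurable[_, ⊤] (G.token t)) :
    Measurable (targetLength M G) := by
  have hE : ∀ t, MeasurableSet {ω | G.token t ω = M.eos} := fun t =>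
    (h t : Measurable[_, ⊤] (G.token t)) (MeasurableSpace.measurableSet_top (s := {M.eos}))
  have hE' : ∀ t, MeasurableSet {ω | 1 ≤ t → G.token t ω ≠ M.eos} := fun t => by
    by_cases ht : 1 ≤ t
    · simp only [ht, true_imp_iff]
      exact (hE t).compl
    · simp [ht]
  refine measurable_to_countable' fun n => ?_
  -- The value `0` is the default of `sInf` on the empty set: it means that EOS never appears at a
  -- time `t ≥ 1`.
  rcases n with _ | n
  · have : targetLength M G ⁻¹' {0} = ⋂ t, {ω | 1 ≤ t → G.token t ω ≠ M.eos} := by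
      ext ω
      simp only [Set.mem_preimage, Set.mem_singleton_iff, targetLength, Nat.sInf_eq_zero,
        Set.mem_ofPred_eq, Set.mem_iInter]
      constructor
      · rintro (h | h)
        · omega
        · intro t ht h'
          have : t ∈ ({t : ℕ | 1 ≤ t ∧ G.token t ω = M.eos} : Set ℕ) := ⟨ht, h'⟩
          rw [h] at this
          exact this
      · intro h
        right
        ext t
        simpa using h t
    rw [this]
    exact MeasurableSet.iInter hE'
  · have : targetLength M G ⁻¹' {n + 1} = {ω | G.token (n + 1) ω = M.eos} ∩
        ⋂ t ∈ Finset.range (n + 1), {ω | 1 ≤ t → G.token t ω ≠ M.eos} := by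
      ext ω
      simp only [Set.mem_preimage, Set.mem_singleton_iff, targetLength, Set.mem_ofPred_eq,
        Set.mem_iInter, Set.mem_inter_iff, Finset.mem_range]
      constructor
      · intro h
        have h1 := Nat.sInf_mem (Nat.nonempty_of_pos_sInf (h.symm.subst (motive := fun k => 0 < k) n.succ_pos))
        rw [h] at h1
        refine ⟨h1.2, fun t ht h1t h' => ?_⟩
        rw [← h] at ht
        exact Nat.notMem_of_lt_sInf ht ⟨h1t, h'⟩
      · rintro ⟨h1, h2⟩
        refine le_antisymm (Nat.sInf_le ⟨by omega, h1⟩) (le_csInf ⟨_, by omega, h1⟩ ?_)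
        rintro t ⟨ht, h'⟩
        by_contra hlt
        exact h2 t (by omega) ht h'
    rw [this]
    exact (hE _).inter (Finset.measurableSet_biInter _ fun t _ => hE' t)

end Measurability

end MetaSD

namespace MetaSD

/-! ### The independent sources and the mean number of accepted tokens -/

section Independence

variable {Ω V : Type*} [MeasurableSpace Ω] [Fintype V] {K : ℕ} {M : Models V K}
  {G : Generation Ω V K} {P : Measure Ω} {ν : Fin K → Measure ℝ}

/-- Index set of the independent sources of randomness of a generation. -/
abbrev SourceIdx (K : ℕ) : Type := Unit ⊕ ((Fin K × ℕ) ⊕ ((Fin K × ℕ) ⊕ Unit))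

variable (M G) in
/-- The independent sources of randomness of a generation: the seed, the coins, the rates and the
target length. -/
noncomputable def source : SourceIdx K → Ω → ℝ :=
  Sum.elim (fun _ => G.seed) (Sum.elim (fun k => G.coin k.1 k.2)
    (Sum.elim (fun k => rate M G k.1 k.2) fun _ ω => (targetLength M G ω : ℝ)))

/-- The hypotheses give independence in layers: `B` from the rates, the coins from both, the seed
from everything else. Gluing the layers in this order yields one mutually independent family. -/
lemma iIndepFun_source [IsProbabilityMeasure P] (hS : StationaryRates M G P ν) (hF : FreshRandomness M G P) :
    iIndepFun (source M G) P := by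
  have hB : Measurable fun (n : ℕ) (_ : Unit) => (n : ℝ) :=
    measurable_pi_iff.2 fun _ => measurable_of_countable _
  have h1 := iIndepFun_sumElim hS.indep_rate
    (iIndepFun_unit (P := P) fun ω => (targetLength M G ω : ℝ))
    (hS.indep_length.comp measurable_id hB)
  have hrb : Measurable fun (p : (Fin K × ℕ → ℝ) × ℕ) (j : (Fin K × ℕ) ⊕ Unit) =>
      Sum.elim p.1 (fun _ => (p.2 : ℝ)) j := by
    refine measurable_pi_iff.2 fun j => ?_
    rcases j with k | _
    · exact (measurable_pi_apply k).comp measurable_fst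
    · exact (measurable_of_countable fun n : ℕ => (n : ℝ)).comp measurable_snd
  have h2 := iIndepFun_sumElim hF.indep_coin h1 (by
    convert hF.indep_coin_rate.comp measurable_id hrb using 1
    all_goals funext ω j
    all_goals first | rfl | (rcases j with k | _ <;> rfl))
  have hcrb : Measurable fun (p : (Fin K × ℕ → ℝ) × (Fin K × ℕ → ℝ) × ℕ)
      (j : (Fin K × ℕ) ⊕ ((Fin K × ℕ) ⊕ Unit)) =>
      Sum.elim p.1 (Sum.elim p.2.1 (fun _ => (p.2.2 : ℝ))) j := by
    refine measurable_pi_iff.2 fun j => ?_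
    rcases j with k | k | _
    · exact (measurable_pi_apply k).comp measurable_fst
    · exact (measurable_pi_apply k).comp (measurable_fst.comp measurable_snd)
    · exact (measurable_of_countable fun n : ℕ => (n : ℝ)).comp
        (measurable_snd.comp measurable_snd)
  have hu : Measurable fun (x : ℝ) (_ : Unit) => x := measurable_pi_iff.2 fun _ => measurable_id
  exact iIndepFun_sumElim (iIndepFun_unit (P := P) G.seed) h2 (by
    convert hF.indep_seed.comp hu hcrb using 1
    all_goals funext ω j
    all_goals first | rfl | (rcases j with k | k | _ <;> rfl))

lemma measurable_source (hT : IsTargetGeneration M G P) (hS : StationaryRates M G P ν)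
    (hF : FreshRandomness M G P) (j : SourceIdx K) : Measurable (source M G j) := by
  rcases j with _ | k | k | _
  · exact hF.measurable_seed
  · exact hF.measurable_coin _ _
  · exact measurable_rate M G _ _ (hS.measurable_ctx _ _)
  · exact (measurable_of_countable fun n : ℕ => (n : ℝ)).comp
      (measurable_targetLength M G hT.measurable_token)

lemma measurable_roundOf (hS : StationaryRates M G P ν) (hF : FreshRandomness M G P) (N : ℕ) :
    Measurable (roundOf M G N) :=
  measurable_pi_iff.2 fun i => measurable_pi_iff.2 fun n =>
    measurable_roundOf_apply M G N i n (fun _ _ => hF.measurable_coin _ _)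
      fun _ _ => measurable_rate M G _ _ (hS.measurable_ctx _ _)

/-- The sources used in the round number `n` played with drafter `i`. -/
def blockIdx (N : ℕ) (i : Fin K) (n : ℕ) : Set (SourceIdx K) :=
  {j | ∃ s, s / N = n ∧ (j = Sum.inr (Sum.inl (i, s)) ∨ j = Sum.inr (Sum.inr (Sum.inl (i, s))))}

/-- The number of tokens accepted in a round is independent of the seed, of the target length and
of all other rounds. -/
lemma indepFun_numAccepted [IsProbabilityMeasure P] (hT : IsTargetGeneration M G P) (hS : StationaryRates M G P ν)
    (hF : FreshRandomness M G P) (N : ℕ) (i : Fin K) (n : ℕ) :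
    IndepFun (numAccepted M G N i n)
      (fun ω => ((G.seed ω, Function.update (roundOf M G N ω) i
        (Function.update (roundOf M G N ω i) n (0, 0))), (targetLength M G ω : ℝ))) P := by
  have hdiv : ∀ n j, j < N → (n * N + j) / N = n := fun n j hj => by
    rw [Nat.div_eq_of_lt_le] <;> nlinarith
  -- Rounds read disjoint blocks of coins and rates, identified by the quotient `s / N`.
  refine indepFun_of_measurable_sigmaOf (iIndepFun_source hS hF) (measurable_source hT hS hF)
    (S := blockIdx N i n) (T := (blockIdx N i n)ᶜ) disjoint_compl_right ?_ ?_
  · refine measurable_numAccepted (m := sigmaOf (source M G) (blockIdx N i n)) M G N i n ?_ ?_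
    · exact fun j hj => measurable_sigmaOf (source M G) (i := Sum.inr (Sum.inl (i, n * N + j)))
        ⟨_, hdiv n j hj, Or.inl rfl⟩
    · exact fun j hj => measurable_sigmaOf (source M G)
        (i := Sum.inr (Sum.inr (Sum.inl (i, n * N + j)))) ⟨_, hdiv n j hj, Or.inr rfl⟩
  · refine measurable_masked (m := sigmaOf (source M G) (blockIdx N i n)ᶜ) i n
      (measurable_sigmaOf (source M G) (i := Sum.inl ()) (by simp [blockIdx]))
      (measurable_sigmaOf (source M G) (i := Sum.inr (Sum.inr (Sum.inr ()))) (by simp [blockIdx]))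
      fun i' n' hne => ?_
    refine measurable_roundOf_apply (m := sigmaOf (source M G) (blockIdx N i n)ᶜ) M G N i' n' ?_ ?_
    · refine fun j hj => measurable_sigmaOf (source M G)
        (i := Sum.inr (Sum.inl (i', n' * N + j))) ?_
      rintro ⟨s, hs, h | h⟩
      · simp only [Sum.inr.injEq, Sum.inl.injEq, Prod.mk.injEq] at h
        exact hne ⟨h.1, by rw [← hs, ← h.2, hdiv _ _ hj]⟩
      · simp at h
    · refine fun j hj => measurable_sigmaOf (source M G)
        (i := Sum.inr (Sum.inr (Sum.inl (i', n' * N + j)))) ?_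
      rintro ⟨s, hs, h | h⟩
      · simp at h
      · simp only [Sum.inr.injEq, Sum.inl.injEq, Prod.mk.injEq] at h
        exact hne ⟨h.1, by rw [← hs, ← h.2, hdiv _ _ hj]⟩

lemma integral_rate (hS : StationaryRates M G P ν) (i : Fin K) (s : ℕ) :
    ∫ ω, rate M G i s ω ∂P = ∫ a, a ∂(ν i) := by
  rw [← hS.law_rate i s]
  exact (integral_map (f := fun a : ℝ => a)
    (measurable_rate M G i s (hS.measurable_ctx i s)).aemeasurable
    measurable_id.aestronglyMeasurable).symm

lemma integrable_rate [IsProbabilityMeasure P] (hS : StationaryRates M G P ν) (i : Fin K) (s : ℕ) :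
    Integrable (rate M G i s) P :=
  Integrable.of_mem_Icc 0 1 (measurable_rate M G i s (hS.measurable_ctx i s)).aemeasurable
    (ae_of_all _ (rate_mem_Icc M G i s))

/-- A drafted token passes the verification with probability the mean acceptance rate. -/
lemma measureReal_accepted [IsProbabilityMeasure P] (hS : StationaryRates M G P ν)
    (hF : FreshRandomness M G P) (i : Fin K) (s : ℕ) :
    P.real {ω | Accepted M G i s ω} = ∫ a, a ∂(ν i) := by
  have hc := hF.measurable_coin i s
  have hr := measurable_rate M G i s (hS.measurable_ctx i s)
  have hind : IndepFun (G.coin i s) (rate M G i s) P :=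
    (iIndepFun_source hS hF).indepFun (i := Sum.inr (Sum.inl (i, s)))
      (j := Sum.inr (Sum.inr (Sum.inl (i, s)))) (by simp)
  have hmap := (indepFun_iff_map_prod_eq_prod_map_map hc.aemeasurable hr.aemeasurable).1 hind
  have hset : MeasurableSet {p : ℝ × ℝ | p.1 < p.2} := measurableSet_lt measurable_fst measurable_snd
  -- Fubini for the independent pair (coin, rate): for a fixed rate `r` in `[0, 1]` the uniform coin
  -- falls below `r` with probability `r`.
  have h1 : P {ω | Accepted M G i s ω} = ∫⁻ ω, ENNReal.ofReal (rate M G i s ω) ∂P := by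
    have e : {ω | Accepted M G i s ω} =
        (fun ω => (G.coin i s ω, rate M G i s ω)) ⁻¹' {p : ℝ × ℝ | p.1 < p.2} := rfl
    have : IsProbabilityMeasure (P.map (rate M G i s)) :=
      Measure.isProbabilityMeasure_map hr.aemeasurable
    rw [e, ← Measure.map_apply (hc.prodMk hr) hset, hmap, hF.law_coin,
      Measure.prod_apply_symm hset, lintegral_map (measurable_measure_prodMk_right hset) hr]
    refine lintegral_congr fun ω => ?_
    have hω := rate_mem_Icc M G i s ω
    have e2 : (fun x : ℝ => (x, rate M G i s ω)) ⁻¹' {p : ℝ × ℝ | p.1 < p.2} =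
        Set.Iio (rate M G i s ω) := rfl
    have e3 : Set.Iio (rate M G i s ω) ∩ Set.Icc 0 1 = Set.Ico 0 (rate M G i s ω) := by
      ext x
      simp only [Set.mem_inter_iff, Set.mem_Iio, Set.mem_Icc, Set.mem_Ico]
      constructor
      · rintro ⟨h, h', -⟩; exact ⟨h', h⟩
      · rintro ⟨h, h'⟩; exact ⟨h', h, h'.le.trans hω.2⟩
    rw [e2, Measure.restrict_apply measurableSet_Iio, e3, Real.volume_Ico, sub_zero]
  rw [measureReal_def, h1, ← ofReal_integral_eq_lintegral_ofReal (integrable_rate hS i s)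
    (ae_of_all _ fun ω => (rate_mem_Icc M G i s ω).1), integral_rate hS,
    ENNReal.toReal_ofReal]
  rw [← integral_rate hS i s]
  exact integral_nonneg fun ω => (rate_mem_Icc M G i s ω).1

/-- The verdicts on different tokens read disjoint sources, so the last one factors out in an
induction on `k`. -/
lemma measureReal_forall_lt_accepted [IsProbabilityMeasure P] (hT : IsTargetGeneration M G P)
    (hS : StationaryRates M G P ν) (hF : FreshRandomness M G P) (i : Fin K) (s k : ℕ) :
    P.real {ω | ∀ j < k, Accepted M G i (s + j) ω} = (∫ a, a ∂(ν i)) ^ k := by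
  induction k with
  | zero => simp
  | succ k ih =>
    let S : Set (SourceIdx K) := {j | ∃ r < s + k, j = Sum.inr (Sum.inl (i, r)) ∨
      j = Sum.inr (Sum.inr (Sum.inl (i, r)))}
    let T : Set (SourceIdx K) := {j | j = Sum.inr (Sum.inl (i, s + k)) ∨
      j = Sum.inr (Sum.inr (Sum.inl (i, s + k)))}
    have hST : Disjoint S T := by
      rw [Set.disjoint_left]
      rintro j ⟨r, hr, h | h⟩ (h' | h') <;> simp [h] at h' <;> omega
    have hf : Measurable[sigmaOf (source M G) S] fun ω => ∀ j < k, Accepted M G i (s + j) ω := by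
      refine (@measurableSet_setOfPred _ (sigmaOf (source M G) S) _).1
        (measurableSet_forall_lt_accepted (m := sigmaOf (source M G) S) M G i s k ?_ ?_)
      · exact fun j hj => measurable_sigmaOf (source M G) (i := Sum.inr (Sum.inl (i, s + j)))
          ⟨_, by omega, Or.inl rfl⟩
      · exact fun j hj => measurable_sigmaOf (source M G)
          (i := Sum.inr (Sum.inr (Sum.inl (i, s + j)))) ⟨_, by omega, Or.inr rfl⟩
    have hg : Measurable[sigmaOf (source M G) T] fun ω => Accepted M G i (s + k) ω := by
      refine (@measurableSet_setOfPred _ (sigmaOf (source M G) T) _).1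
        (measurableSet_accepted (m := sigmaOf (source M G) T) M G i (s + k) ?_ ?_)
      · exact measurable_sigmaOf (source M G) (i := Sum.inr (Sum.inl (i, s + k))) (Or.inl rfl)
      · exact measurable_sigmaOf (source M G) (i := Sum.inr (Sum.inr (Sum.inl (i, s + k))))
          (Or.inr rfl)
    have hind := indepFun_of_measurable_sigmaOf (iIndepFun_source hS hF)
      (measurable_source hT hS hF) hST hf hg
    have := hind.measure_inter_preimage_eq_mul {True} {True} (measurableSet_singleton _)
      (measurableSet_singleton _)
    have e : {ω | ∀ j < k + 1, Accepted M G i (s + j) ω} =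
        (fun ω => ∀ j < k, Accepted M G i (s + j) ω) ⁻¹' {True} ∩
          (fun ω => Accepted M G i (s + k) ω) ⁻¹' {True} := by
      ext ω
      simp only [Set.mem_inter_iff, Set.mem_preimage, Set.mem_singleton_iff, eq_iff_iff, iff_true,
        Nat.lt_succ_iff_lt_or_eq]
      constructor
      · exact fun h => ⟨fun j hj => h j (Or.inl hj), h k (Or.inr rfl)⟩
      · rintro ⟨h, h'⟩ j (hj | rfl)
        exacts [h j hj, h']
    have e1 : (fun ω => ∀ j < k, Accepted M G i (s + j) ω) ⁻¹' {True} =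
        {ω | ∀ j < k, Accepted M G i (s + j) ω} := by ext ω; simp
    have e2 : (fun ω => Accepted M G i (s + k) ω) ⁻¹' {True} =
        {ω | Accepted M G i (s + k) ω} := by ext ω; simp
    rw [measureReal_def, e, this, ENNReal.toReal_mul, e1, e2, ← measureReal_def,
      ← measureReal_def, ih, measureReal_accepted hS hF, pow_succ]

/-- The length of the initial run is the sum over `j < N` of the indicators that the first `j + 1`
tokens all pass. -/
lemma integral_numAccepted [IsProbabilityMeasure P] (hT : IsTargetGeneration M G P)
    (hS : StationaryRates M G P ν) (hF : FreshRandomness M G P) (N : ℕ) (i : Fin K) (n : ℕ) :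
    ∫ ω, (numAccepted M G N i n ω : ℝ) ∂P =
      ∑ j ∈ Finset.range N, (∫ a, a ∂(ν i)) ^ (j + 1) := by
  have hms : ∀ j, MeasurableSet {ω | ∀ j' < j + 1, Accepted M G i (n * N + j') ω} := fun j =>
    measurableSet_forall_lt_accepted M G i (n * N) (j + 1) (fun _ _ => hF.measurable_coin _ _)
      fun _ _ => measurable_rate M G _ _ (hS.measurable_ctx _ _)
  have e : ∀ ω, (numAccepted M G N i n ω : ℝ) = ∑ j ∈ Finset.range N,
      Set.indicator {ω | ∀ j' < j + 1, Accepted M G i (n * N + j') ω} (fun _ => (1 : ℝ)) ω := by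
    intro ω
    classical
    unfold numAccepted
    rw [Finset.card_filter, Nat.cast_sum]
    refine Finset.sum_congr rfl fun j _ => ?_
    simp only [Set.indicator_apply, Set.mem_ofPred_eq, Nat.lt_succ_iff]
    split_ifs <;> simp
  simp only [e]
  rw [integral_finsetSum _ fun j _ => (integrable_const (1 : ℝ)).indicator (hms j)]
  refine Finset.sum_congr rfl fun j _ => ?_
  rw [integral_indicator_const _ (hms j), measureReal_forall_lt_accepted hT hS hF, smul_eq_mul,
    mul_one]

end Independence

end MetaSD

namespace MetaSD

/-! ### Wald's identity for an adaptively chosen sequence of rounds -/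

section Wald

variable {Ω V : Type*} [Fintype V] {K : ℕ}

/-- The history of the first `t` rounds as a function of the observations in all possible rounds. -/
noncomputable abbrev run (M : Models V K) (G : Generation Ω V K) (N : ℕ) (π : Policy K) (ω : Ω)
    (t : ℕ) : Fin t → Obs K :=
  historyOf π (G.seed ω) (roundOf M G N ω) t

lemma sum_mul_pulls_historyOf_succ (π : Policy K) (u : ℝ) (Y : Fin K → ℕ → ℕ × ℝ) (t : ℕ)
    (m : Fin K → ℝ) :
    ∑ i, m i * pulls (historyOf π u Y (t + 1)) i =
      ∑ i, m i * pulls (historyOf π u Y t) i + m (π.act t u (historyOf π u Y t)) := by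
  simp only [pulls_historyOf_succ, Nat.cast_add, mul_add, Finset.sum_add_distrib, Nat.cast_ite,
    Nat.cast_one, Nat.cast_zero, mul_ite, mul_one, mul_zero, Finset.sum_ite_eq, Finset.mem_univ,
    if_true]

/-- Tokens generated minus expected number of tokens in the rounds of a history. -/
noncomputable def excess (m : Fin K → ℝ) {t : ℕ} (h : Fin t → Obs K) : ℝ :=
  tokensOf h - ∑ i, m i * pulls h i

lemma excess_historyOf_succ (π : Policy K) (u : ℝ) (Y : Fin K → ℕ → ℕ × ℝ) (t : ℕ)
    (m : Fin K → ℝ) :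
    excess m (historyOf π u Y (t + 1)) = excess m (historyOf π u Y t) +
      (((Y (π.act t u (historyOf π u Y t))
        (pulls (historyOf π u Y t) (π.act t u (historyOf π u Y t)))).1 : ℝ) + 1 -
        m (π.act t u (historyOf π u Y t))) := by
  unfold excess
  rw [sum_mul_pulls_historyOf_succ, tokensOf_historyOf_succ]
  push_cast
  ring

variable [MeasurableSpace Ω] {M : Models V K} {G : Generation Ω V K} {P : Measure Ω}
  {ν : Fin K → Measure ℝ}

lemma measurable_run (hS : StationaryRates M G P ν) (hF : FreshRandomness M G P) (N : ℕ)
    (π : Policy K) (t : ℕ) : Measurable fun ω => run M G N π ω t :=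
  (measurable_historyOf π t).comp (hF.measurable_seed.prodMk (measurable_roundOf hS hF N))

lemma measurable_stoppingTime (hT : IsTargetGeneration M G P) (hS : StationaryRates M G P ν)
    (hF : FreshRandomness M G P) (N : ℕ) (π : Policy K) :
    Measurable (stoppingTime M G N π) := by
  refine measurable_of_Ioi fun k => ?_
  have : stoppingTime M G N π ⁻¹' Set.Ioi k =
      {ω | tokensOf (run M G N π ω k) < targetLength M G ω} := by
    ext ω
    exact lt_stoppingTime_iff M G N π ω k
  rw [this]
  exact measurableSet_lt (measurable_tokensOf.comp (measurable_run hS hF N π k))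
    (measurable_targetLength M G hT.measurable_token)

lemma measurable_at_nat {f : ℕ → Ω → ℝ} (hf : ∀ t, Measurable (f t)) {τ : Ω → ℕ}
    (hτ : Measurable τ) : Measurable fun ω => f (τ ω) ω :=
  (measurable_from_prod_countable_right (f := fun p : ℕ × Ω => f p.1 p.2) hf).comp
    (hτ.prodMk measurable_id)

lemma integrable_stoppingTime (hT : IsTargetGeneration M G P) (hS : StationaryRates M G P ν)
    (hF : FreshRandomness M G P) (N : ℕ) (π : Policy K) :
    Integrable (fun ω => (stoppingTime M G N π ω : ℝ)) P := by
  refine hT.integrable_length.mono' ((measurable_of_countable _).comp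
    (measurable_stoppingTime hT hS hF N π)).aestronglyMeasurable (ae_of_all _ fun ω => ?_)
  rw [Real.norm_natCast]
  exact_mod_cast stoppingTime_le M G N π ω

lemma measurable_excess (m : Fin K → ℝ) (t : ℕ) :
    Measurable fun h : Fin t → Obs K => excess m h := by
  unfold excess
  refine ((measurable_of_countable _).comp measurable_tokensOf).sub
    (Finset.measurable_sum _ fun i _ => ?_)
  exact ((measurable_of_countable (fun n : ℕ => (n : ℝ))).comp (measurable_pulls i)).const_mul _

/-- The contribution of one round to the excess of a stopped run has mean zero. -/
lemma integral_excess_increment [IsProbabilityMeasure P] (hT : IsTargetGeneration M G P)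
    (hS : StationaryRates M G P ν) (hF : FreshRandomness M G P) (N : ℕ) (π : Policy K)
    (m : Fin K → ℝ) (hm : ∀ i n, ∫ ω, (numAccepted M G N i n ω : ℝ) ∂P = m i - 1) (k : ℕ) :
    ∫ ω, (if k < stoppingTime M G N π ω then
      excess m (run M G N π ω (k + 1)) - excess m (run M G N π ω k) else 0) ∂P = 0 := by
  classical
  let Q : ℝ → ℝ → Fin K → (Fin k → Obs K) → Prop := fun u B i h =>
    π.act k u h = i ∧ (tokensOf h : ℝ) < B
  -- Indicator that the round after the first `k` is the `n`-th one of drafter `i` and that the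
  -- target is not yet reached.
  let ψ : Fin K → ℕ → ((ℝ × (Fin K → ℕ → ℕ × ℝ)) × ℝ) → ℝ := fun i n z =>
    if pulls (historyOf π z.1.1 z.1.2 k) i = n ∧ Q z.1.1 z.2 i (historyOf π z.1.1 z.1.2 k)
    then 1 else 0
  have hψ : ∀ i n, Measurable (ψ i n) := by
    intro i n
    have hh : Measurable fun z : (ℝ × (Fin K → ℕ → ℕ × ℝ)) × ℝ => historyOf π z.1.1 z.1.2 k :=
      (measurable_historyOf π k).comp measurable_fst
    refine Measurable.ite ?_ measurable_const measurable_const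
    refine MeasurableSet.inter ?_ (MeasurableSet.inter ?_ ?_)
    · exact ((measurable_pulls i).comp hh) (measurableSet_singleton n)
    · exact ((π.measurable_act k).comp ((measurable_fst.comp measurable_fst).prodMk hh))
        (measurableSet_singleton i)
    · exact measurableSet_lt ((measurable_of_countable _).comp (measurable_tokensOf.comp hh))
        measurable_snd
  let Z : Fin K → ℕ → Ω → ((ℝ × (Fin K → ℕ → ℕ × ℝ)) × ℝ) := fun i n ω =>
    ((G.seed ω, Function.update (roundOf M G N ω) i
        (Function.update (roundOf M G N ω i) n (0, 0))), (targetLength M G ω : ℝ))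
  have hZ : ∀ i n, Measurable (Z i n) := fun i n =>
    measurable_masked i n hF.measurable_seed ((measurable_of_countable _).comp
      (measurable_targetLength M G hT.measurable_token)) fun i' n' _ =>
        (measurable_pi_apply n').comp ((measurable_pi_apply i').comp (measurable_roundOf hS hF N))
  have hnum : ∀ i n, Measurable fun ω => (numAccepted M G N i n ω : ℝ) := fun i n =>
    (measurable_of_countable _).comp (measurable_fst.comp ((measurable_pi_apply n).comp
      ((measurable_pi_apply i).comp (measurable_roundOf hS hF N))))
  have hint : ∀ i n, Integrable (fun ω => (numAccepted M G N i n ω : ℝ)) P := fun i n =>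
    Integrable.of_mem_Icc 0 N (hnum i n).aemeasurable (ae_of_all _ fun ω =>
      ⟨by positivity, by exact_mod_cast numAccepted_le M G N i n ω⟩)
  -- The indicator only sees the masked table, which is independent of the centred token count of
  -- round `(i, n)`.
  have hzero : ∀ i n, ∫ ω, ψ i n (Z i n ω) * ((numAccepted M G N i n ω : ℝ) + (1 - m i)) ∂P = 0 := by
    intro i n
    have hind := ((indepFun_numAccepted hT hS hF N i n).comp
      (measurable_of_countable fun y : ℕ => (y : ℝ) + (1 - m i)) (hψ i n)).symm
    have := hind.integral_fun_mul_eq_mul_integral ((hψ i n).comp (hZ i n)).aestronglyMeasurable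
      ((hnum i n).add_const _).aestronglyMeasurable
    refine this.trans ?_
    have h0 : ∫ ω, ((fun y : ℕ => (y : ℝ) + (1 - m i)) ∘ numAccepted M G N i n) ω ∂P = 0 := by
      simp only [Function.comp_apply]
      rw [integral_add (hint i n) (integrable_const _), hm]
      simp
    rw [h0, mul_zero]
  -- Exactly one pair `(i, n)` is the round played, and `n ≤ k`; masking its own outcome does not
  -- change the indicator.
  have hsum : ∀ ω, (if k < stoppingTime M G N π ω then
      excess m (run M G N π ω (k + 1)) - excess m (run M G N π ω k) else 0) =
      ∑ i, ∑ n ∈ Finset.range (k + 1),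
        ψ i n (Z i n ω) * ((numAccepted M G N i n ω : ℝ) + (1 - m i)) := by
    intro ω
    have hψZ : ∀ i n, ψ i n (Z i n ω) =
        if pulls (run M G N π ω k) i = n ∧ Q (G.seed ω) (targetLength M G ω) i (run M G N π ω k)
        then 1 else 0 := fun i n => by
      simp only [ψ, Z]
      exact if_congr (historyOf_update_and_iff π (G.seed ω) (roundOf M G N ω) i n (0, 0) k
        (Q (G.seed ω) (targetLength M G ω) i)) rfl rfl
    simp only [hψZ, lt_stoppingTime_iff, Q]
    set A := π.act k (G.seed ω) (run M G N π ω k) with hA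
    rw [Finset.sum_eq_single A, Finset.sum_eq_single (pulls (run M G N π ω k) A)]
    · by_cases h : tokensOf (run M G N π ω k) < targetLength M G ω
      · rw [if_pos h, if_pos ⟨rfl, rfl, by exact_mod_cast h⟩, excess_historyOf_succ,
          add_sub_cancel_left, one_mul, add_sub_assoc]
        rfl
      · rw [if_neg h, if_neg fun h' => h (by exact_mod_cast h'.2.2), zero_mul]
    · intro n _ hn
      rw [if_neg fun h => hn h.1.symm, zero_mul]
    · intro h
      exact absurd (Finset.mem_range.2 (Nat.lt_succ_of_le (pulls_le _ _))) h
    · intro i _ hi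
      refine Finset.sum_eq_zero fun n _ => ?_
      rw [if_neg fun h => hi h.2.1.symm, zero_mul]
    · simp
  have hψb : ∀ i n z, ‖ψ i n z‖ ≤ 1 := fun i n z => by
    simp only [ψ]; split_ifs <;> simp
  have hI : ∀ i n, Integrable
      (fun ω => ψ i n (Z i n ω) * ((numAccepted M G N i n ω : ℝ) + (1 - m i))) P := fun i n =>
    ((hint i n).add (integrable_const _)).bdd_mul ((hψ i n).comp (hZ i n)).aestronglyMeasurable
      (ae_of_all _ fun ω => hψb i n _)
  simp only [hsum]
  rw [integral_finsetSum _ fun i _ => integrable_finsetSum _ fun n _ => hI i n]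
  refine Finset.sum_eq_zero fun i _ => ?_
  rw [integral_finsetSum _ fun n _ => hI i n]
  exact Finset.sum_eq_zero fun n _ => hzero i n

/-- Wald's identity for the number of tokens generated until the stopping time. -/
lemma integral_excess_stoppingTime [IsProbabilityMeasure P] (hT : IsTargetGeneration M G P)
    (hS : StationaryRates M G P ν) (hF : FreshRandomness M G P) (N : ℕ) (π : Policy K)
    (m : Fin K → ℝ) (hm : ∀ i n, ∫ ω, (numAccepted M G N i n ω : ℝ) ∂P = m i - 1)
    (hm0 : ∀ i, 0 ≤ m i) (hmN : ∀ i, m i ≤ N + 1) :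
    Integrable (fun ω => excess m (run M G N π ω (stoppingTime M G N π ω))) P ∧
    ∫ ω, excess m (run M G N π ω (stoppingTime M G N π ω)) ∂P = 0 := by
  let W : ℕ → Ω → ℝ := fun k ω => if k < stoppingTime M G N π ω then
      excess m (run M G N π ω (k + 1)) - excess m (run M G N π ω k) else 0
  have hτ := measurable_stoppingTime hT hS hF N π
  have hWm : ∀ k, Measurable (W k) := fun k =>
    Measurable.ite (measurableSet_lt measurable_const hτ)
      (((measurable_excess m _).comp (measurable_run hS hF N π (k + 1))).sub
        ((measurable_excess m _).comp (measurable_run hS hF N π k))) measurable_const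
  have hinc : ∀ k ω, |excess m (run M G N π ω (k + 1)) - excess m (run M G N π ω k)| ≤ N + 1 := by
    intro k ω
    rw [excess_historyOf_succ, add_sub_cancel_left]
    set i := π.act k (G.seed ω) (run M G N π ω k)
    set n := pulls (run M G N π ω k) i
    have h1 : (numAccepted M G N i n ω : ℝ) ≤ N := by exact_mod_cast numAccepted_le M G N i n ω
    have h0 : (0 : ℝ) ≤ numAccepted M G N i n ω := by positivity
    have := hm0 i
    have := hmN i
    simp only [roundOf]
    rw [abs_le]
    constructor <;> linarith
  -- The increments telescope to the excess of the run stopped at `min t τ`.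
  have hpart : ∀ t ω, ∑ k ∈ Finset.range t, W k ω =
      excess m (run M G N π ω (min t (stoppingTime M G N π ω))) := by
    intro t ω
    induction t with
    | zero =>
      rw [Nat.zero_min]
      simp [excess, tokensOf, pulls]
    | succ t ih =>
      rw [Finset.sum_range_succ, ih]
      simp only [W]
      split_ifs with h
      · rw [min_eq_left h.le, min_eq_left (by omega : t + 1 ≤ _)]
        ring
      · rw [min_eq_right (by omega), min_eq_right (by omega), add_zero]
  -- At most `τ ≤ B` increments are nonzero, each at most `N + 1` in absolute value: an integrable
  -- bound for dominated convergence.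
  have hbound : ∀ t ω, ‖∑ k ∈ Finset.range t, W k ω‖ ≤
      (N + 1) * (targetLength M G ω : ℝ) := by
    intro t ω
    have h1 : ∑ k ∈ Finset.range t, W k ω =
        ∑ k ∈ Finset.range (min t (stoppingTime M G N π ω)), W k ω := by
      rw [hpart, hpart, min_assoc, min_self]
    rw [h1]
    refine (norm_sum_le_of_le (f := fun k => W k ω) (n := fun _ => (N : ℝ) + 1) _
      fun k _ => ?_).trans ?_
    · simp only [W]
      split_ifs
      · exact hinc k ω
      · rw [norm_zero]; positivity
    · rw [Finset.sum_const, Finset.card_range, nsmul_eq_mul, mul_comm]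
      have : min t (stoppingTime M G N π ω) ≤ targetLength M G ω :=
        (min_le_right _ _).trans (stoppingTime_le M G N π ω)
      gcongr
  have hlim : ∀ ω, Filter.Tendsto (fun t => ∑ k ∈ Finset.range t, W k ω) Filter.atTop
      (nhds (excess m (run M G N π ω (stoppingTime M G N π ω)))) := by
    intro ω
    refine tendsto_const_nhds.congr' ?_
    filter_upwards [Filter.eventually_ge_atTop (stoppingTime M G N π ω)] with t ht
    rw [hpart, min_eq_right ht]
  have hmeas : ∀ t, Measurable fun ω => ∑ k ∈ Finset.range t, W k ω := fun t =>
    Finset.measurable_sum _ fun k _ => hWm k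
  have hBint : Integrable (fun ω => (N + 1) * (targetLength M G ω : ℝ)) P :=
    hT.integrable_length.const_mul _
  have hWint : ∀ k, Integrable (W k) P := fun k =>
    (integrable_const ((N : ℝ) + 1)).mono' (hWm k).aestronglyMeasurable (ae_of_all _ fun ω => by
      simp only [W]
      split_ifs
      · exact hinc k ω
      · rw [norm_zero]; positivity)
  constructor
  · refine hBint.mono' (measurable_at_nat (fun t =>
      (measurable_excess m _).comp (measurable_run hS hF N π t)) hτ).aestronglyMeasurable
      (ae_of_all _ fun ω => ?_)
    have := hbound (stoppingTime M G N π ω) ω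
    rwa [hpart, min_self] at this
  · have hconv := tendsto_integral_of_dominated_convergence _
      (fun t => (hmeas t).aestronglyMeasurable) hBint (fun t => ae_of_all P (hbound t))
      (ae_of_all P hlim)
    refine tendsto_nhds_unique hconv (tendsto_const_nhds.congr fun t => ?_)
    rw [integral_finsetSum _ fun k _ => hWint k]
    exact (Finset.sum_eq_zero fun k _ =>
      integral_excess_increment hT hS hF N π m hm k).symm

end Wald

end MetaSD

namespace MetaSD

/-! ### Lower and upper bounds on the expected stopping time -/

section Bounds

variable {Ω V : Type*} [Fintype V] {K : ℕ} [MeasurableSpace Ω] {M : Models V K}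
  {G : Generation Ω V K} {P : Measure Ω} {ν : Fin K → Measure ℝ}

lemma integrable_pulls_run (hT : IsTargetGeneration M G P) (hS : StationaryRates M G P ν)
    (hF : FreshRandomness M G P) (N : ℕ) (π : Policy K) (i : Fin K) :
    Integrable (fun ω => (pulls (run M G N π ω (stoppingTime M G N π ω)) i : ℝ)) P := by
  refine hT.integrable_length.mono' (measurable_at_nat
    (f := fun t ω => (pulls (run M G N π ω t) i : ℝ)) (fun t =>
      (measurable_of_countable _).comp ((measurable_pulls i).comp (measurable_run hS hF N π t)))
      (measurable_stoppingTime hT hS hF N π)).aestronglyMeasurable (ae_of_all _ fun ω => ?_)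
  rw [Real.norm_natCast]
  exact_mod_cast (pulls_le _ _).trans (stoppingTime_le M G N π ω)

/-- Every policy needs on average at least `E[B]` divided by the largest expected number of tokens
per round. -/
lemma expectedLength_div_le [IsProbabilityMeasure P] (hT : IsTargetGeneration M G P)
    (hS : StationaryRates M G P ν) (hF : FreshRandomness M G P) (N : ℕ) (π : Policy K)
    (m : Fin K → ℝ) (hm : ∀ i n, ∫ ω, (numAccepted M G N i n ω : ℝ) ∂P = m i - 1)
    (hm0 : ∀ i, 0 ≤ m i) (hmN : ∀ i, m i ≤ N + 1) {mstar : ℝ} (hpos : 0 < mstar)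
    (hle : ∀ i, m i ≤ mstar) :
    expectedLength M G P / mstar ≤ expectedStoppingTime M G P N π := by
  obtain ⟨hint, hzero⟩ := integral_excess_stoppingTime hT hS hF N π m hm hm0 hmN
  have hτ := integrable_stoppingTime hT hS hF N π
  -- Pointwise the excess is at least `B - mstar * τ`, because the play counts sum to `τ`; its mean
  -- is zero.
  have h := integral_mono (μ := P)
    (f := fun ω => (targetLength M G ω : ℝ) - mstar * (stoppingTime M G N π ω : ℝ))
    (hT.integrable_length.sub (hτ.const_mul _)) hint fun ω => by
      have h1 : (targetLength M G ω : ℝ) ≤ tokensOf (run M G N π ω (stoppingTime M G N π ω)) := by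
        exact_mod_cast targetLength_le_tokensOf M G N π ω
      have h2 : ∑ i, m i * (pulls (run M G N π ω (stoppingTime M G N π ω)) i : ℝ) ≤
          mstar * (stoppingTime M G N π ω : ℝ) := by
        conv_rhs => rw [← sum_pulls (run M G N π ω (stoppingTime M G N π ω))]
        rw [Nat.cast_sum, Finset.mul_sum]
        exact Finset.sum_le_sum fun i _ => mul_le_mul_of_nonneg_right (hle i) (Nat.cast_nonneg _)
      simp only [excess]
      linarith
  rw [hzero, integral_sub hT.integrable_length (hτ.const_mul _), integral_const_mul] at h
  rw [div_le_iff₀ hpos]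
  unfold expectedLength expectedStoppingTime
  linarith

/-- The expected stopping time in terms of the expected numbers of suboptimal rounds. -/
lemma mul_expectedStoppingTime_le [IsProbabilityMeasure P] (hT : IsTargetGeneration M G P)
    (hS : StationaryRates M G P ν) (hF : FreshRandomness M G P) (N : ℕ) (π : Policy K)
    (m : Fin K → ℝ) (hm : ∀ i n, ∫ ω, (numAccepted M G N i n ω : ℝ) ∂P = m i - 1)
    (hm0 : ∀ i, 0 ≤ m i) (hmN : ∀ i, m i ≤ N + 1) (istar : Fin K) :
    m istar * expectedStoppingTime M G P N π ≤ expectedLength M G P + N +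
      ∑ i ∈ Finset.univ.erase istar, (m istar - m i) *
        ∫ ω, (pulls (run M G N π ω (stoppingTime M G N π ω)) i : ℝ) ∂P := by
  obtain ⟨hint, hzero⟩ := integral_excess_stoppingTime hT hS hF N π m hm hm0 hmN
  have hτ := integrable_stoppingTime hT hS hF N π
  have hp := fun i => integrable_pulls_run hT hS hF N π i
  have hBN : Integrable (fun ω => (targetLength M G ω : ℝ) + N) P :=
    hT.integrable_length.add (integrable_const _)
  have hsum : Integrable (fun ω => ∑ i ∈ Finset.univ.erase istar, (m istar - m i) *
      (pulls (run M G N π ω (stoppingTime M G N π ω)) i : ℝ)) P :=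
    integrable_finsetSum _ fun i _ => (hp i).const_mul _
  -- Here tokens are at most `B + N`, and `m istar * τ` is distributed over the drafters; the term
  -- of `istar` cancels.
  have h := integral_mono (μ := P) (f := fun ω => excess m (run M G N π ω (stoppingTime M G N π ω))
      + m istar * (stoppingTime M G N π ω : ℝ))
    (g := fun ω => ((targetLength M G ω : ℝ) + N) + ∑ i ∈ Finset.univ.erase istar,
      (m istar - m i) * (pulls (run M G N π ω (stoppingTime M G N π ω)) i : ℝ))
    (hint.add (hτ.const_mul _))
    (hBN.add hsum) fun ω => by
      have h1 : (tokensOf (run M G N π ω (stoppingTime M G N π ω)) : ℝ) ≤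
          targetLength M G ω + N := by
        exact_mod_cast tokensOf_le M G N π ω
      have h2 : m istar * (stoppingTime M G N π ω : ℝ) =
          ∑ i, m istar * (pulls (run M G N π ω (stoppingTime M G N π ω)) i : ℝ) := by
        conv_lhs => rw [← sum_pulls (run M G N π ω (stoppingTime M G N π ω))]
        rw [Nat.cast_sum, Finset.mul_sum]
      have h3 : ∑ i ∈ Finset.univ.erase istar,
          (m istar - m i) * (pulls (run M G N π ω (stoppingTime M G N π ω)) i : ℝ) =
          ∑ i, m istar * (pulls (run M G N π ω (stoppingTime M G N π ω)) i : ℝ) -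
          ∑ i, m i * (pulls (run M G N π ω (stoppingTime M G N π ω)) i : ℝ) := by
        rw [Finset.sum_erase _ (by simp), ← Finset.sum_sub_distrib]
        exact Finset.sum_congr rfl fun i _ => by ring
      simp only [excess]
      linarith
  rw [integral_add hint (hτ.const_mul _), hzero, integral_const_mul,
    integral_add hBN hsum,
    integral_add hT.integrable_length (integrable_const _),
    integral_finsetSum _ fun i _ => (hp i).const_mul _] at h
  simp only [integral_const_mul, integral_const, probReal_univ, one_smul, zero_add] at h
  exact h

end Bounds

/-! ### Hoeffding bounds for the confidence intervals -/

section Concentration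

variable {Ω V : Type*} [Fintype V] {K : ℕ} [MeasurableSpace Ω] {M : Models V K}
  {G : Generation Ω V K} {P : Measure Ω} {ν : Fin K → Measure ℝ}

/-- Hoeffding's inequality: centred variables with values in an interval of length one are
sub-Gaussian with parameter `1/4`. -/
lemma measureReal_sum_rate_sub_ge_le [IsProbabilityMeasure P] (hS : StationaryRates M G P ν)
    (i : Fin K) (n : ℕ) {ε : ℝ} (hε : 0 ≤ ε) :
    P.real {ω | ε ≤ ∑ l ∈ Finset.range n, (rate M G i l ω - ∫ a, a ∂(ν i))} ≤
      Real.exp (-2 * ε ^ 2 / n) ∧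
    P.real {ω | ε ≤ ∑ l ∈ Finset.range n, ((∫ a, a ∂(ν i)) - rate M G i l ω)} ≤
      Real.exp (-2 * ε ^ 2 / n) := by
  have hind : iIndepFun (fun l : ℕ => rate M G i l) P :=
    hS.indep_rate.precomp (g := fun l : ℕ => (i, l)) fun a b h => (Prod.mk.inj h).2
  have hsub : ∀ l, HasSubgaussianMGF (fun ω => rate M G i l ω - ∫ a, a ∂(ν i))
      ((‖(1 : ℝ) - 0‖₊ / 2) ^ 2) P := fun l => by
    rw [← integral_rate hS i l]
    exact hasSubgaussianMGF_of_mem_Icc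
      (measurable_rate M G i l (hS.measurable_ctx i l)).aemeasurable
      (ae_of_all _ (rate_mem_Icc M G i l))
  have hc : -ε ^ 2 / (2 * ((∑ _l ∈ Finset.range n, (‖(1 : ℝ) - 0‖₊ / 2) ^ 2 : NNReal) : ℝ)) =
      -2 * ε ^ 2 / n := by
    rcases Nat.eq_zero_or_pos n with rfl | hn
    · simp
    · have : (n : ℝ) ≠ 0 := by positivity
      simp
      field_simp
  constructor
  · have := HasSubgaussianMGF.measure_sum_ge_le_of_iIndepFun
      (hind.comp (fun _ x => x - ∫ a, a ∂(ν i)) fun _ => measurable_id.sub_const _)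
      (s := Finset.range n) (fun l _ => hsub l) hε
    rw [hc] at this
    exact this
  · have := HasSubgaussianMGF.measure_sum_ge_le_of_iIndepFun
      (hind.comp (fun _ x => (∫ a, a ∂(ν i)) - x) fun _ => measurable_id.const_sub _)
      (s := Finset.range n) (c := fun _ => (‖(1 : ℝ) - 0‖₊ / 2) ^ 2)
      (fun l _ => by
        convert (hsub l).neg using 1
        funext ω
        simp) hε
    rw [hc] at this
    exact this

/-- The width of the confidence interval after `t` rounds for a drafter played `s` times. -/
noncomputable def bonus (N t s : ℕ) : ℝ :=
  1 / Real.sqrt N * Real.sqrt (2 * Real.log t / s)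

variable (M G) in
/-- The mean of the first `s` rewards of drafter `i`. -/
noncomputable def meanReward (N : ℕ) (i : Fin K) (s : ℕ) (ω : Ω) : ℝ :=
  (∑ l ∈ Finset.range (s * N), rate M G i l ω) / (N * s)

variable (M G) in
/-- After `t` rounds, the reward mean `a` of drafter `i` lies below some confidence interval. -/
def TooHigh (N : ℕ) (i : Fin K) (a : ℝ) (t : ℕ) : Set Ω :=
  ⋃ s ∈ Finset.Icc 1 t, {ω | a + bonus N t s ≤ meanReward M G N i s ω}

variable (M G) in
/-- After `t` rounds, the reward mean `a` of drafter `i` lies above some confidence interval. -/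
def TooLow (N : ℕ) (i : Fin K) (a : ℝ) (t : ℕ) : Set Ω :=
  ⋃ s ∈ Finset.Icc 1 t, {ω | meanReward M G N i s ω + bonus N t s ≤ a}

lemma bonus_nonneg (N t s : ℕ) : 0 ≤ bonus N t s := by unfold bonus; positivity

/-- Rewards of `s` rounds average `s * N` independent rates. The factor `1/√N` in the width exactly
uses up this gain, leaving the exponent `-4 ln t`, free of `N` and `s`. -/
lemma exp_bonus {N t s : ℕ} (hN : 1 ≤ N) (ht : 1 ≤ t) (hs : 1 ≤ s) :
    Real.exp (-2 * (N * s * bonus N t s) ^ 2 / (s * N : ℕ)) = ((t : ℝ) ^ 4)⁻¹ := by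
  have hN' : (0 : ℝ) < N := by exact_mod_cast hN
  have hs' : (0 : ℝ) < s := by exact_mod_cast hs
  have ht' : (0 : ℝ) < t := by exact_mod_cast ht
  have hl : 0 ≤ Real.log t := Real.log_nonneg (by exact_mod_cast ht)
  have hb : bonus N t s ^ 2 = 1 / N * (2 * Real.log t / s) := by
    unfold bonus
    rw [mul_pow, div_pow, Real.sq_sqrt hN'.le, Real.sq_sqrt (by positivity), one_pow]
  have : -2 * (N * s * bonus N t s) ^ 2 / (s * N : ℕ) = -(4 * Real.log t) := by
    rw [mul_pow, hb]
    push_cast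
    field_simp
    ring
  rw [this, Real.exp_neg]
  congr 1
  rw [show (4 : ℝ) * Real.log t = ((4 : ℕ) : ℝ) * Real.log t by norm_num, Real.exp_nat_mul,
    Real.exp_log ht']

/-- The play count is random, so all `t` possible values are covered, at the cost of a factor `t`.
-/
lemma measureReal_biUnion_Icc_le {t : ℕ} {E : ℕ → Set Ω}
    (h : ∀ s ∈ Finset.Icc 1 t, P.real (E s) ≤ ((t : ℝ) ^ 4)⁻¹) :
    P.real (⋃ s ∈ Finset.Icc 1 t, E s) ≤ 1 / (t : ℝ) ^ 3 := by
  refine (measureReal_biUnion_finset_le _ _).trans ((Finset.sum_le_sum h).trans ?_)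
  rcases Nat.eq_zero_or_pos t with rfl | ht
  · simp
  · rw [Finset.sum_const, Nat.card_Icc, nsmul_eq_mul, Nat.add_sub_cancel]
    have : (t : ℝ) ≠ 0 := by positivity
    apply le_of_eq
    field_simp

lemma measureReal_tooHigh_le [IsProbabilityMeasure P] (hS : StationaryRates M G P ν)
    {N : ℕ} (hN : 1 ≤ N) (i : Fin K) (t : ℕ) :
    P.real (TooHigh M G N i (∫ a, a ∂(ν i)) t) ≤ 1 / (t : ℝ) ^ 3 := by
  refine measureReal_biUnion_Icc_le fun s hs => ?_
  rw [Finset.mem_Icc] at hs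
  have hN' : (0 : ℝ) < N := by exact_mod_cast hN
  have hs' : (0 : ℝ) < s := by exact_mod_cast hs.1
  have := (measureReal_sum_rate_sub_ge_le hS i (s * N) (ε := N * s * bonus N t s)
    (mul_nonneg (by positivity) (bonus_nonneg _ _ _))).1
  rw [exp_bonus hN (hs.1.trans hs.2) hs.1] at this
  refine le_trans (measureReal_mono fun ω hω => ?_) this
  simp only [Set.mem_ofPred_eq, meanReward] at hω ⊢
  rw [le_div_iff₀ (by positivity)] at hω
  rw [Finset.sum_sub_distrib, Finset.sum_const, Finset.card_range, nsmul_eq_mul]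
  push_cast
  linarith

lemma measureReal_tooLow_le [IsProbabilityMeasure P] (hS : StationaryRates M G P ν)
    {N : ℕ} (hN : 1 ≤ N) (i : Fin K) (t : ℕ) :
    P.real (TooLow M G N i (∫ a, a ∂(ν i)) t) ≤ 1 / (t : ℝ) ^ 3 := by
  refine measureReal_biUnion_Icc_le fun s hs => ?_
  rw [Finset.mem_Icc] at hs
  have hN' : (0 : ℝ) < N := by exact_mod_cast hN
  have hs' : (0 : ℝ) < s := by exact_mod_cast hs.1
  have := (measureReal_sum_rate_sub_ge_le hS i (s * N) (ε := N * s * bonus N t s)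
    (mul_nonneg (by positivity) (bonus_nonneg _ _ _))).2
  rw [exp_bonus hN (hs.1.trans hs.2) hs.1] at this
  refine le_trans (measureReal_mono fun ω hω => ?_) this
  simp only [Set.mem_ofPred_eq, meanReward] at hω ⊢
  rw [← le_sub_iff_add_le, div_le_iff₀ (by positivity)] at hω
  rw [Finset.sum_sub_distrib, Finset.sum_const, Finset.card_range, nsmul_eq_mul]
  push_cast
  linarith

lemma measurable_meanReward (hS : StationaryRates M G P ν) (N : ℕ) (i : Fin K) (s : ℕ) :
    Measurable (meanReward M G N i s) := by
  unfold meanReward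
  exact (Finset.measurable_sum _ fun l _ =>
    measurable_rate M G i l (hS.measurable_ctx i l)).div_const _

lemma measurableSet_tooHigh (hS : StationaryRates M G P ν) (N : ℕ) (i : Fin K) (a : ℝ) (t : ℕ) :
    MeasurableSet (TooHigh M G N i a t) :=
  Finset.measurableSet_biUnion _ fun s _ =>
    measurableSet_le measurable_const (measurable_meanReward hS N i s)

lemma measurableSet_tooLow (hS : StationaryRates M G P ν) (N : ℕ) (i : Fin K) (a : ℝ) (t : ℕ) :
    MeasurableSet (TooLow M G N i a t) :=
  Finset.measurableSet_biUnion _ fun s _ =>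
    measurableSet_le ((measurable_meanReward hS N i s).add_const _) measurable_const

/-- If the probabilities of a sequence of events are summable, then an integrable random variable
bounds how many of the events happen. -/
lemma exists_integrable_bound_count [IsProbabilityMeasure P] {E : ℕ → Set Ω}
    (hE : ∀ k, MeasurableSet (E k)) {c : ℕ → ℝ} (hc : Summable c) (h : ∀ k, P.real (E k) ≤ c k) :
    ∃ R : Ω → ℝ, Integrable R P ∧ ∫ ω, R ω ∂P ≤ ∑' k, c k ∧
      ∀ᵐ ω ∂P, ∀ t, ∑ k ∈ Finset.range t, (E k).indicator (fun _ => (1 : ℝ)) ω ≤ R ω := by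
  -- The total number of events that happen. It bounds every partial count at once, so a random
  -- horizon can be inserted later without any independence.
  let F : Ω → ENNReal := fun ω => ∑' k, (E k).indicator (fun _ => (1 : ENNReal)) ω
  have hc0 : ∀ k, 0 ≤ c k := fun k => measureReal_nonneg.trans (h k)
  have hFm : Measurable F := Measurable.tsum fun k => measurable_const.indicator (hE k)
  have hF : ∫⁻ ω, F ω ∂P ≤ ENNReal.ofReal (∑' k, c k) := by
    rw [lintegral_tsum fun k => (measurable_const.indicator (hE k)).aemeasurable,
      ENNReal.ofReal_tsum_of_nonneg hc0 hc]
    refine ENNReal.tsum_le_tsum fun k => ?_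
    rw [lintegral_indicator_const (hE k), one_mul, ← ofReal_measureReal]
    exact ENNReal.ofReal_le_ofReal (h k)
  have hFtop : ∫⁻ ω, F ω ∂P ≠ ⊤ := ne_top_of_le_ne_top ENNReal.ofReal_ne_top hF
  have hae := ae_lt_top hFm hFtop
  refine ⟨fun ω => (F ω).toReal, integrable_toReal_of_lintegral_ne_top hFm.aemeasurable hFtop,
    ?_, ?_⟩
  · rw [integral_toReal hFm.aemeasurable hae]
    exact ENNReal.toReal_le_of_le_ofReal (tsum_nonneg hc0) hF
  · filter_upwards [hae] with ω hω t
    have h1 : ∑ k ∈ Finset.range t, (E k).indicator (fun _ => (1 : ENNReal)) ω ≤ F ω :=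
      ENNReal.sum_le_tsum _
    have h2 := ENNReal.toReal_mono hω.ne h1
    rw [ENNReal.toReal_sum fun k _ => by
      by_cases hk : ω ∈ E k <;> simp [hk]] at h2
    refine le_of_eq_of_le (Finset.sum_congr rfl fun k _ => ?_) h2
    by_cases hk : ω ∈ E k <;> simp [hk]

end Concentration

end MetaSD

namespace MetaSD

/-! ### Pathwise analysis of the UCB rule -/

section UCB

variable {Ω V : Type*} [Fintype V] {K : ℕ} {M : Models V K} {G : Generation Ω V K}

/-- Although plays are adaptive, the rewards seen from `i` are an initial segment of its row.
Concentration is thus needed only for fixed sample sizes. -/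
lemma sum_reward_historyOf (π : Policy K) (u : ℝ) (Y : Fin K → ℕ → ℕ × ℝ) (t : ℕ) (i : Fin K) :
    ∑ k ∈ Finset.univ.filter (fun k => (historyOf π u Y t k).1 = i), (historyOf π u Y t k).2.2 =
      ∑ n ∈ Finset.range (pulls (historyOf π u Y t) i), (Y i n).2 := by
  induction t with
  | zero => simp [pulls]
  | succ t ih =>
    rw [Finset.sum_filter] at ih ⊢
    rw [Fin.sum_univ_castSucc, pulls_historyOf_succ]
    simp only [historyOf, Fin.snoc_castSucc, Fin.snoc_last]
    rw [ih]
    split_ifs with h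
    · rw [Finset.sum_range_succ, h]
    · rw [add_zero, add_zero]

lemma sum_bdReward (N : ℕ) (i : Fin K) (s : ℕ) (ω : Ω) :
    ∑ n ∈ Finset.range s, bdReward M G N i n ω =
      (1 / (N : ℝ)) * ∑ l ∈ Finset.range (s * N), rate M G i l ω := by
  induction s with
  | zero => simp
  | succ s ih =>
    rw [Finset.sum_range_succ, ih, Nat.succ_mul, Finset.sum_range_add, mul_add]
    rfl

lemma ucbIndex_run (N : ℕ) (π : Policy K) (ω : Ω) (t : ℕ) (i : Fin K) :
    ucbIndex (1 / Real.sqrt N) (run M G N π ω t) i =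
      meanReward M G N i (pulls (run M G N π ω t) i) ω +
        bonus N t (pulls (run M G N π ω t) i) := by
  unfold ucbIndex empMean bonus meanReward
  rw [sum_reward_historyOf]
  simp only [roundOf]
  rw [sum_bdReward, one_div, inv_mul_eq_div, div_div]

lemma one_le_pulls_run {β : ℝ} {π : Policy K} (hπ : IsMetaSDUCB β π) (N : ℕ) (ω : Ω) {t : ℕ}
    (ht : K ≤ t) (i : Fin K) : 1 ≤ pulls (run M G N π ω t) i := by
  refine le_trans ?_ (pulls_historyOf_mono π (G.seed ω) (roundOf M G N ω) i
    ((Nat.succ_le_of_lt i.2).trans ht))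
  simp only [pulls_historyOf_succ]
  rw [if_pos (Fin.ext ((hπ i _ _).1 i.2))]
  omega

/-- A drafter that was played often enough is only played again if some confidence interval
fails. -/
lemma mem_tooHigh_or_tooLow {N : ℕ} (hN : 1 ≤ N) {π : Policy K}
    (hπ : IsMetaSDUCB (1 / Real.sqrt (N : ℝ)) π) (ω : Ω) {k t : ℕ} (hKk : K ≤ k) (hkt : k ≤ t)
    {i istar : Fin K} {a astar : ℝ} (ha : a < astar)
    (hact : π.act k (G.seed ω) (run M G N π ω k) = i)
    (hpulls : 8 * Real.log t / (N * (astar - a) ^ 2) ≤ pulls (run M G N π ω k) i) :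
    ω ∈ TooHigh M G N i a k ∪ TooLow M G N istar astar k := by
  by_contra hcon
  simp only [TooHigh, TooLow, Set.mem_union, Set.mem_iUnion, Finset.mem_Icc, Set.mem_ofPred_eq,
    not_or, not_exists, not_le] at hcon
  have hN' : (0 : ℝ) < N := by exact_mod_cast hN
  have h1 := hcon.1 (pulls (run M G N π ω k) i) ⟨one_le_pulls_run hπ N ω hKk i, pulls_le _ _⟩
  have h2 := hcon.2 (pulls (run M G N π ω k) istar) ⟨one_le_pulls_run hπ N ω hKk istar, pulls_le _ _⟩
  have h3 := (hπ k (G.seed ω) (run M G N π ω k)).2 hKk istar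
  rw [hact, ucbIndex_run, ucbIndex_run] at h3
  have hp : (1 : ℝ) ≤ pulls (run M G N π ω k) i := by
    exact_mod_cast one_le_pulls_run hπ N ω hKk i
  set p : ℕ := pulls (run M G N π ω k) i
  have hk : (1 : ℝ) ≤ k := hp.trans (Nat.cast_le.2 (pulls_le _ _))
  have hlog : Real.log k ≤ Real.log t := Real.log_le_log (by linarith) (by exact_mod_cast hkt)
  have hlog0 : 0 ≤ Real.log k := Real.log_nonneg hk
  have hΔ : 0 < astar - a := by linarith
  -- The threshold `8 ln t / (N Δ²)` is what makes `2 ln k / (N p) ≤ (Δ/2)²`.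
  have hb : bonus N k p ≤ (astar - a) / 2 := by
    refine le_of_sq_le_sq ?_ (by positivity)
    rw [bonus, mul_pow, div_pow, Real.sq_sqrt hN'.le, Real.sq_sqrt (by positivity), one_pow]
    rw [div_le_iff₀ (by positivity)] at hpulls
    rw [div_mul_div_comm, one_mul, div_le_iff₀ (by positivity)]
    nlinarith
  -- If all intervals hold, the index of `i` is below `a + 2 * bonus ≤ astar`, which is below the
  -- index of `istar`, so `i` would not be played.
  linarith

/-- The initial rounds contribute at most `K` plays; a later play either starts from a count below
`ℓ`, leaving it below `ℓ + 1`, or is charged to `b k`. -/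
lemma pulls_le_add_count (π : Policy K) (u : ℝ) (Y : Fin K → ℕ → ℕ × ℝ) (i : Fin K) {ℓ : ℝ}
    (hℓ : 0 ≤ ℓ) {b : ℕ → ℝ} (hb : ∀ k, 0 ≤ b k) (t : ℕ)
    (h : ∀ k < t, K ≤ k → π.act k u (historyOf π u Y k) = i →
      ℓ ≤ pulls (historyOf π u Y k) i → 1 ≤ b k) :
    (pulls (historyOf π u Y t) i : ℝ) ≤ ℓ + 1 + K + ∑ k ∈ Finset.range t, b k := by
  induction t with
  | zero => simp [pulls]; positivity
  | succ t ih =>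
    have ih := ih fun k hk => h k (by omega)
    rw [Finset.sum_range_succ]
    have hs : 0 ≤ ∑ k ∈ Finset.range t, b k := Finset.sum_nonneg fun k _ => hb k
    have hbt := hb t
    have hK : (0 : ℝ) ≤ K := Nat.cast_nonneg _
    by_cases hKt : K ≤ t
    · rw [pulls_historyOf_succ]
      split_ifs with hact
      · push_cast
        by_cases hp : ℓ ≤ pulls (historyOf π u Y t) i
        · linarith [h t (by omega) hKt hact hp]
        · linarith
      · push_cast
        linarith
    · have : ((pulls (historyOf π u Y (t + 1)) i : ℕ) : ℝ) ≤ K := by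
        exact_mod_cast (pulls_le _ _).trans (by omega)
      linarith

end UCB

lemma ae_one_le_targetLength {Ω V : Type*} {K : ℕ} [MeasurableSpace Ω] {M : Models V K}
    {G : Generation Ω V K} {P : Measure Ω} (hT : IsTargetGeneration M G P) :
    ∀ᵐ ω ∂P, 1 ≤ targetLength M G ω := by
  filter_upwards [hT.eos_appears] with ω hω
  exact (Nat.sInf_mem hω).1

lemma one_le_expectedLength {Ω V : Type*} {K : ℕ} [MeasurableSpace Ω] {M : Models V K}
    {G : Generation Ω V K} {P : Measure Ω} [IsProbabilityMeasure P]
    (hT : IsTargetGeneration M G P) : 1 ≤ expectedLength M G P := by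
  have h : ∫ _ω, (1 : ℝ) ∂P ≤ expectedLength M G P :=
    integral_mono_ae (integrable_const (1 : ℝ)) hT.integrable_length
      ((ae_one_le_targetLength hT).mono fun ω h => Nat.one_le_cast.2 h)
  simpa only [integral_const, probReal_univ, one_smul] using h

/-! ### The logarithmic regret bound -/

section Regret

variable {Ω V : Type*} [Fintype V] {K : ℕ} [MeasurableSpace Ω] {M : Models V K}
  {G : Generation Ω V K} {P : Measure Ω} {ν : Fin K → Measure ℝ}

/-- MetaSD-UCB plays a suboptimal drafter rarely. -/
lemma integral_pulls_le [IsProbabilityMeasure P] (hT : IsTargetGeneration M G P)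
    (hS : StationaryRates M G P ν) (hF : FreshRandomness M G P) {N : ℕ} (hN : 1 ≤ N)
    {π : Policy K} (hπ : IsMetaSDUCB (1 / Real.sqrt (N : ℝ)) π) {i istar : Fin K}
    (hlt : ∫ a, a ∂(ν i) < ∫ a, a ∂(ν istar)) :
    ∫ ω, (pulls (run M G N π ω (stoppingTime M G N π ω)) i : ℝ) ∂P ≤
      8 / (N * ((∫ a, a ∂(ν istar)) - ∫ a, a ∂(ν i)) ^ 2) * Real.log (expectedLength M G P) +
        (1 + K + ∑' k : ℕ, 2 / (k : ℝ) ^ 3) := by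
  set a := ∫ a, a ∂(ν i) with ha
  set astar := ∫ a, a ∂(ν istar) with hastar
  set E : ℕ → Set Ω := fun k => TooHigh M G N i a k ∪ TooLow M G N istar astar k with hE
  set μB := expectedLength M G P with hμB
  set D : ℝ := 8 / (N * (astar - a) ^ 2) with hD
  have hB1 : 1 ≤ μB := one_le_expectedLength hT
  have hD0 : 0 ≤ D := by positivity
  have hEm : ∀ k, MeasurableSet (E k) := fun k =>
    (measurableSet_tooHigh hS N i a k).union (measurableSet_tooLow hS N istar astar k)
  have hEP : ∀ k, P.real (E k) ≤ 2 / (k : ℝ) ^ 3 := fun k => by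
    refine (measureReal_union_le _ _).trans ?_
    have h1 := measureReal_tooHigh_le hS hN i k
    have h2 := measureReal_tooLow_le hS hN istar k
    have e : 2 / (k : ℝ) ^ 3 = 1 / (k : ℝ) ^ 3 + 1 / (k : ℝ) ^ 3 := by ring
    rw [e]
    exact add_le_add h1 h2
  have hc : Summable fun k : ℕ => 2 / (k : ℝ) ^ 3 := by
    have := (Real.summable_one_div_nat_pow (p := 3)).2 (by norm_num)
    simpa only [mul_one_div] using this.mul_left 2
  obtain ⟨R, hRint, hRle, hR⟩ := exists_integrable_bound_count hEm hc hEP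
  have hae : ∀ᵐ ω ∂P, (pulls (run M G N π ω (stoppingTime M G N π ω)) i : ℝ) ≤
      (D / μB * (targetLength M G ω : ℝ) + (D * (Real.log μB - 1) + (1 + K))) + R ω := by
    filter_upwards [hR, ae_one_le_targetLength hT] with ω hRω hBω
    set B := targetLength M G ω with hB
    have hB' : (1 : ℝ) ≤ B := by exact_mod_cast hBω
    have h1 : (pulls (run M G N π ω (stoppingTime M G N π ω)) i : ℝ) ≤
        pulls (run M G N π ω B) i := by
      exact_mod_cast pulls_historyOf_mono π (G.seed ω) (roundOf M G N ω) i
        (stoppingTime_le M G N π ω)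
    have h2 := pulls_le_add_count π (G.seed ω) (roundOf M G N ω) i
      (ℓ := D * Real.log B) (mul_nonneg hD0 (Real.log_nonneg hB'))
      (b := fun k => (E k).indicator (fun _ => (1 : ℝ)) ω)
      (fun k => Set.indicator_nonneg (fun _ _ => zero_le_one) ω) B
      fun k hk hKk hact hp => by
        have : ω ∈ E k := mem_tooHigh_or_tooLow hN hπ ω hKk hk.le hlt hact
          (by rwa [mul_div_right_comm])
        simp [this]
    -- Tangent line of `ln` at `E[B]`: the bound is linear in `B`, and its mean is `ln E[B]`, as in
    -- Jensen's inequality.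
    have h3 : Real.log B ≤ Real.log μB + (B / μB - 1) := by
      have := Real.log_le_sub_one_of_pos (x := B / μB) (by positivity)
      rw [Real.log_div (by positivity) (by positivity)] at this
      linarith
    have h4 := mul_le_mul_of_nonneg_left h3 hD0
    have h5 := hRω B
    have h6 : D / μB * (B : ℝ) = D * (B / μB) := by ring
    rw [h6]
    linarith
  have hlin : Integrable (fun ω => D / μB * (targetLength M G ω : ℝ)) P :=
    hT.integrable_length.const_mul _
  have hlin' : Integrable (fun ω => D / μB * (targetLength M G ω : ℝ) +
      (D * (Real.log μB - 1) + (1 + K))) P := hlin.add (integrable_const _)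
  have h := integral_mono_ae (integrable_pulls_run hT hS hF N π i) (hlin'.add hRint) hae
  refine h.trans ?_
  have e : ∫ ω, (D / μB * (targetLength M G ω : ℝ) + (D * (Real.log μB - 1) + (1 + K))) + R ω ∂P =
      D * Real.log μB + (1 + K) + ∫ ω, R ω ∂P := by
    rw [integral_add hlin' hRint, integral_add hlin (integrable_const _), integral_const_mul]
    have : ∫ ω, (targetLength M G ω : ℝ) ∂P = μB := rfl
    rw [this, div_mul_cancel₀ _ (by positivity)]
    simp
    ring
  refine e.le.trans ?_
  linarith

/-- The regret of MetaSD-UCB is logarithmic in the expected target length. -/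
lemma expectedRegret_le [IsProbabilityMeasure P] (hT : IsTargetGeneration M G P)
    (hS : StationaryRates M G P ν) (hF : FreshRandomness M G P) {N : ℕ} (hN : 1 ≤ N)
    {π : Policy K} (hπ : IsMetaSDUCB (1 / Real.sqrt (N : ℝ)) π) {istar : Fin K}
    (hlt : ∀ i, i ≠ istar → ∫ a, a ∂(ν i) < ∫ a, a ∂(ν istar)) :
    expectedRegret M G P N π ≤ N + ∑ i ∈ Finset.univ.erase istar,
      (8 / (N * ((∫ a, a ∂(ν istar)) - ∫ a, a ∂(ν i)) ^ 2) * Real.log (expectedLength M G P) +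
        (1 + K + ∑' k : ℕ, 2 / (k : ℝ) ^ 3)) := by
  set a : Fin K → ℝ := fun i => ∫ a, a ∂(ν i) with ha
  have ha0 : ∀ i, 0 ≤ a i := fun i => by
    simp only [ha]
    rw [← integral_rate hS i 0]
    exact integral_nonneg fun ω => (rate_mem_Icc M G i 0 ω).1
  have ha1 : ∀ i, a i ≤ 1 := fun i => by
    simp only [ha]
    rw [← integral_rate hS i 0]
    simpa using integral_mono (integrable_rate hS i 0) (integrable_const (1 : ℝ))
      fun ω => (rate_mem_Icc M G i 0 ω).2
  -- Mean tokens per round; the leading `1` is the token every round yields besides the accepted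
  -- ones.
  set m : Fin K → ℝ := fun i => 1 + ∑ j ∈ Finset.range N, a i ^ (j + 1) with hmdef
  have hm : ∀ i n, ∫ ω, (numAccepted M G N i n ω : ℝ) ∂P = m i - 1 := fun i n => by
    rw [integral_numAccepted hT hS hF, hmdef, add_sub_cancel_left]
  have hm1 : ∀ i, 1 ≤ m i := fun i =>
    le_add_of_nonneg_right (Finset.sum_nonneg fun j _ => pow_nonneg (ha0 i) _)
  have hm0 : ∀ i, 0 ≤ m i := fun i => zero_le_one.trans (hm1 i)
  have hmN : ∀ i, m i ≤ N + 1 := fun i => by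
    have : ∑ j ∈ Finset.range N, a i ^ (j + 1) ≤ ∑ _j ∈ Finset.range N, (1 : ℝ) :=
      Finset.sum_le_sum fun j _ => pow_le_one₀ (ha0 i) (ha1 i)
    simp only [Finset.sum_const, Finset.card_range, nsmul_eq_mul, mul_one] at this
    simp only [hmdef]
    linarith
  have hle : ∀ i, m i ≤ m istar := fun i => by
    have hai : a i ≤ a istar := by
      by_cases h : i = istar
      · rw [h]
      · exact (hlt i h).le
    exact add_le_add_right (Finset.sum_le_sum fun j _ => pow_le_pow_left₀ (ha0 i) hai _) _
  have hpos : 0 < m istar := zero_lt_one.trans_le (hm1 istar)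
  have hinf : expectedLength M G P / m istar ≤ ⨅ π' : Policy K, expectedStoppingTime M G P N π' := by
    have : Nonempty (Policy K) := ⟨π⟩
    exact le_ciInf fun π' => expectedLength_div_le hT hS hF N π' m hm hm0 hmN hpos hle
  have hup := mul_expectedStoppingTime_le hT hS hF N π m hm hm0 hmN istar
  set L := expectedLength M G P
  set T := expectedStoppingTime M G P N π
  set S := ∑ i ∈ Finset.univ.erase istar,
      (8 / (N * (a istar - a i) ^ 2) * Real.log L + (1 + K + ∑' k : ℕ, 2 / (k : ℝ) ^ 3))
  -- The crude `m istar - m i ≤ m istar` suffices: after division by `m istar` each suboptimal round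
  -- costs at most one round.
  have hsum : ∑ i ∈ Finset.univ.erase istar, (m istar - m i) *
      ∫ ω, (pulls (run M G N π ω (stoppingTime M G N π ω)) i : ℝ) ∂P ≤ m istar * S := by
    rw [Finset.mul_sum]
    refine Finset.sum_le_sum fun i hi => ?_
    have hp := integral_pulls_le hT hS hF hN hπ (hlt i (Finset.ne_of_mem_erase hi))
    exact mul_le_mul (by linarith [hm0 i]) hp (integral_nonneg fun ω => Nat.cast_nonneg _) hpos.le
  have hNle : (N : ℝ) ≤ m istar * N := le_mul_of_one_le_left (Nat.cast_nonneg _) (hm1 istar)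
  have hfin : T ≤ L / m istar + N + S := by
    rw [← mul_le_mul_iff_right₀ hpos]
    have : m istar * (L / m istar + N + S) = L + m istar * N + m istar * S := by
      field_simp
    rw [this]
    linarith
  unfold expectedRegret
  linarith

end Regret

end MetaSD

/-! ### Absorbing the constants and the iterated logarithm -/

theorem mainTheorem8 (K Nmax : ℕ) (hN : 1 ≤ Nmax) (s₀ : ℝ) (hs₀ : 1 < s₀) :
    ∃ C C' : ℝ, 0 < C ∧ 0 < C' ∧
      ∀ {Ω V : Type*} [MeasurableSpace Ω] [Fintype V]
        (P : Measure Ω) [IsProbabilityMeasure P]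
        (M : MetaSD.Models V K) (G : MetaSD.Generation Ω V K)
        (ν : Fin K → Measure ℝ) (α : Fin K → ℝ) (istar : Fin K) (π : MetaSD.Policy K),
        MetaSD.IsTargetGeneration M G P →
        MetaSD.StationaryRates M G P ν →
        MetaSD.FreshRandomness M G P →
        (∀ i, α i = ∫ a, a ∂(ν i)) →
        (∀ i, i ≠ istar → α i < α istar) →
        s₀ ≤ ∑ i ∈ Finset.univ.erase istar, 1 / (α istar - α i) ^ 2 →
        MetaSD.IsMetaSDUCB (1 / Real.sqrt (Nmax : ℝ)) π →
        MetaSD.expectedRegret M G P Nmax π <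
          ∑ i ∈ Finset.univ.erase istar,
            8 / ((Nmax : ℝ) * (α istar - α i) ^ 2) *
              (Real.log (MetaSD.expectedLength M G P) +
                Real.log (Real.log
                  (∑ j ∈ Finset.univ.erase istar, 1 / (α istar - α j) ^ 2)) + C') + C := by
  have hc0 : (0 : ℝ) ≤ ∑' k : ℕ, 2 / (k : ℝ) ^ 3 := tsum_nonneg fun k => by positivity
  -- `C` collects the overshoot and the constant term of at most `K` drafters, with `+ 1` for
  -- strictness. `C'` offsets `ln ln s₀`, which is negative when `s₀ < e`.
  refine ⟨Nmax + K * (1 + K + ∑' k : ℕ, 2 / (k : ℝ) ^ 3) + 1, |Real.log (Real.log s₀)| + 1,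
    by positivity, by positivity, ?_⟩
  intro Ω V _ _ P _ M G ν α istar π hT hS hF hα hlt hs hπ
  obtain rfl : α = fun i => ∫ a, a ∂(ν i) := funext hα
  have hreg := MetaSD.expectedRegret_le hT hS hF hN hπ hlt
  set Λ := ∑ j ∈ Finset.univ.erase istar, 1 / ((∫ a, a ∂(ν istar)) - ∫ a, a ∂(ν j)) ^ 2
  have hlog : 0 < Real.log s₀ := Real.log_pos hs₀
  have hΛ : Real.log (Real.log s₀) ≤ Real.log (Real.log Λ) :=
    Real.log_le_log hlog (Real.log_le_log (by linarith) hs)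
  have hC' : 0 ≤ Real.log (Real.log Λ) + (|Real.log (Real.log s₀)| + 1) := by
    linarith [neg_abs_le (Real.log (Real.log s₀))]
  refine hreg.trans_lt ?_
  rw [Finset.sum_add_distrib, Finset.sum_const, nsmul_eq_mul]
  have h1 : ∑ i ∈ Finset.univ.erase istar,
      8 / (Nmax * ((∫ a, a ∂(ν istar)) - ∫ a, a ∂(ν i)) ^ 2) *
        Real.log (MetaSD.expectedLength M G P) ≤
      ∑ i ∈ Finset.univ.erase istar,
      8 / (Nmax * ((∫ a, a ∂(ν istar)) - ∫ a, a ∂(ν i)) ^ 2) *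
        (Real.log (MetaSD.expectedLength M G P) + Real.log (Real.log Λ) +
          (|Real.log (Real.log s₀)| + 1)) :=
    Finset.sum_le_sum fun i _ => mul_le_mul_of_nonneg_left (by linarith) (by positivity)
  have h2 : ((Finset.univ.erase istar).card : ℝ) * (1 + K + ∑' k : ℕ, 2 / (k : ℝ) ^ 3) ≤
      K * (1 + K + ∑' k : ℕ, 2 / (k : ℝ) ^ 3) := by
    refine mul_le_mul_of_nonneg_right ?_ (by positivity)
    exact_mod_cast (Finset.card_le_univ _).trans (by simp)
  linarith
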